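/- **Setting.** Let $\mathcal G$ be an undirected graph on $m\ge 2$ agents. A gossip matrix for $\mathcal G$ is a symmetric positive semidefinite $W\in\mathbb R^{m\times m}$ with $W_{ij}\ne 0$ only if $i=j$ or $\{i,j\}$ is an edge, and with null space spanned by the all-ones vector $\mathbf 1$; its eigengap is $\lambda_2(W)/\lambda_m(W)$, where $\lambda_1\le\dots\le\lambda_m$ are its eigenvalues. For local costs $f_i:\mathbb R^d\to\mathbb R$, $i=1,\dots,m$, and $\mathbf x=[x_1,\dots,x_m]^\top\in\mathbb R^{m\times d}$ (Frobenius norm) put $f(\mathbf x)=\sum_i f_i(x_i)$. If $x^\star$ is a minimizer of $\sum_i f_i$ over $\mathbb R^d$, put $\mathbf x^\star=\mathbf 1(x^\star)^\top$ and $G(\mathbf x)=f(\mathbf x)-f(\mathbf x^\star)-\langle\nabla f(\mathbf x^\star),\mathbf x-\mathbf x^\star\rangle$. "$L$-smooth" means differentiable with $L$-Lipschitz gradient. With gradient evaluations taking time $1$ and communications with neighbors taking time $\tau_c>0$, a decentralized first-order gossip algorithm (oracle class $\mathcal A$) generates $(\mathbf x^{(t)})_{t\ge0}$ with $\mathbf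 x^{(0)}=0$ and, for all $t\ge 0$ and all $i$, $$x_i^{(t)}\in\mathrm{span}\{x_j^{(s)}:\{i,j\}\text{ an edge},\,0\le s<t-\tau_c\}+\mathrm{span}\{x_i^{(s)},\nabla f_i(x_i^{(s)}):0\le s<t-1\}.$$ **Theorem.** There are absolute constants $c,C>0$ such that the following holds. For every $\eta\in(0,1]$ and $L_f>0$ there are an $m\ge2$, a connected graph $\mathcal G$ on $m$ agents and a gossip matrix for $\mathcal G$ with eigengap equal to $\eta$ such that, for every $d\in\mathbb N$, every $\tau_c>0$ and every $t\in\big[0,\tfrac{d-1}{2}\big(1+\lceil\tfrac1{5\sqrt\eta}\rceil\tau_c\big)\big]$, there are convex $L_f$-smooth local costs $f_1,\dots,f_m:\mathbb R^d\to\mathbb R$, with $f$ also $L_f$-smooth and with $\sum_i f_i$ having a minimizer, such that for every minimizer $x^\star$, with $R=\|\mathbf x^{(0)}-\mathbf x^\star\|=\|\mathbf x^\star\|$ and $T=t/\big(1+\lceil\tfrac1{5\sqrt\eta}\rceil\tau_c\big)$: one has $R>0$; every algorithm in $\mathcal A$ satisfies $$G(\mathbf x^{(t)})\ \ge\ c\left(\frac{L_fR^2}{(T+2)^2}+\frac{R\,\|\nabla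 f(\mathbf x^\star)\|}{T+2}\right);$$ and the two terms are of the same order: $$c\,R\,\|\nabla f(\mathbf x^\star)\|\ \le\ \frac{L_fR^2}{T+2}\ \le\ C\,R\,\|\nabla f(\mathbf x^\star)\| .$$ -/

import Mathlib

open scoped RealInnerProductSpace

namespace DecentralizedOpt

noncomputable section

/-- The space `ℝ^d` with its Euclidean norm. -/
abbrev Vec (d : ℕ) : Type := EuclideanSpace ℝ (Fin d)

/-- The space `ℝ^{m × d}` of stacked vectors `𝐱 = [x_1, …, x_m]`, one row in `ℝ^d` per agent, with
the Frobenius inner product and norm. -/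
abbrev Stack (m d : ℕ) : Type := PiLp 2 (fun _ : Fin m => Vec d)

/-- `W` is a gossip matrix for the graph `G`: it is symmetric positive semidefinite, it is induced
by `G` (an off-diagonal entry is nonzero only if it sits on an edge), and its null space is spanned
by the all-ones vector. -/
structure IsGossipMatrix {m : ℕ} (G : SimpleGraph (Fin m)) (W : Matrix (Fin m) (Fin m) ℝ) :
    Prop where
  induced : ∀ i j, W i j ≠ 0 → i = j ∨ G.Adj i j
  posSemidef : W.PosSemidef
  ker_eq : LinearMap.ker (Matrix.toLin' W) = Submodule.span ℝ {fun _ : Fin m => (1 : ℝ)}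

/-- The eigengap `λ_2 / λ_m` of a symmetric `m × m` matrix with `m ≥ 2`, where
`λ_1 ≤ λ_2 ≤ … ≤ λ_m` are its eigenvalues counted with multiplicity. The family
`Matrix.IsHermitian.eigenvalues₀` lists them in decreasing order, so that `λ_m` has index `0` and
`λ_2` has index `m - 2`. -/
def eigengap {m : ℕ} (hm : 2 ≤ m) {W : Matrix (Fin m) (Fin m) ℝ} (hW : W.IsHermitian) : ℝ :=
  hW.eigenvalues₀ ⟨m - 2, by rw [Fintype.card_fin]; omega⟩ /
    hW.eigenvalues₀ ⟨0, by rw [Fintype.card_fin]; omega⟩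

/-- A real function on a Hilbert space is `L`-smooth if it is differentiable and its gradient is
`L`-Lipschitz. -/
def IsSmooth {E : Type*} [NormedAddCommGroup E] [InnerProductSpace ℝ E] [CompleteSpace E]
    (L : ℝ) (g : E → ℝ) : Prop :=
  Differentiable ℝ g ∧ ∀ x y : E, ‖gradient g x - gradient g y‖ ≤ L * ‖x - y‖

/-- `xs` is a solution of the problem of minimizing `F(x) = ∑ i, f_i(x)` over `ℝ^d`. -/
def IsSolution {m d : ℕ} (f : Fin m → Vec d → ℝ) (xs : Vec d) : Prop :=
  ∀ y : Vec d, ∑ i, f i xs ≤ ∑ i, f i y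

/-- The separable cost `f(𝐱) = ∑ i, f_i(x_i)` on stacked vectors. -/
def stackedCost {m d : ℕ} (f : Fin m → Vec d → ℝ) (x : Stack m d) : ℝ :=
  ∑ i, f i (x i)

/-- The consensual stacked vector all of whose rows are `v`. -/
def consensus (m : ℕ) {d : ℕ} (v : Vec d) : Stack m d :=
  WithLp.toLp 2 (fun _ => v)

/-- The Bregman distance `G(𝐱, 𝐱⋆) = f(𝐱) - f(𝐱⋆) - ⟨∇f(𝐱⋆), 𝐱 - 𝐱⋆⟩` of the separable cost. -/
def bregman {m d : ℕ} (f : Fin m → Vec d → ℝ) (x xs : Stack m d) : ℝ :=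
  stackedCost f x - stackedCost f xs - ⟪gradient (stackedCost f) xs, x - xs⟫

/-- The trajectory `x` (stacked vectors indexed by the times `t ≥ 0`) can be generated by a
decentralized first-order gossip algorithm on the graph `G` for the local costs `f`, when a gradient
evaluation takes one unit of time and a communication with the neighbors takes time `τ`: it starts
at zero, and at each time `t ≥ 0` the variable of each agent lies in the sum of the span of the
values that its neighbors held before `t - τ` and the span of its own values and local gradients
before `t - 1`. -/
def IsGossipTrajectory {m d : ℕ} (G : SimpleGraph (Fin m)) (τ : ℝ) (f : Fin m → Vec d → ℝ)
    (x : ℝ → Stack m d) : Prop :=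
  x 0 = 0 ∧ ∀ t : ℝ, 0 ≤ t → ∀ i : Fin m,
    x t i ∈
      Submodule.span ℝ {v | ∃ j, G.Adj i j ∧ ∃ s : ℝ, 0 ≤ s ∧ s < t - τ ∧ v = x s j} ⊔
      Submodule.span ℝ
        {v | ∃ s : ℝ, 0 ≤ s ∧ s < t - 1 ∧ (v = x s i ∨ v = gradient (f i) (x s i))}

/-- The time scale `1 + ⌈1 / (5 √η)⌉ τ`. -/
def timeScale (η τ : ℝ) : ℝ :=
  1 + (⌈1 / (5 * √η)⌉₊ : ℝ) * τ

end

end DecentralizedOpt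

/-!
The bound combines a slow network with a chain of coordinates that can only be discovered one at a
time.

*Network.* Put `D = ⌈1 / (5 √η)⌉`. The agents sit on a path of `N ≲ 1 / √η` positions, three copies
at each position. On the averages over the copies the gossip matrix acts as a scaled path
Laplacian; on the two contrasts between the copies at one position it acts as multiplication by `η`
and by `1`. A crude Poincaré inequality on the path puts every eigenvalue of the Laplacian part,
except the one of the all-ones vector, into `[η, 1]`, so that the contrasts carry the extreme
nonzero eigenvalues and the eigengap is exactly `η` (`exists_isGossipMatrix_gossip`). Two sets `A`
and `B` of equal size, each containing at least a quarter of the agents, lie at distance at least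
`D` at the two ends of the path, or, if `D = 1`, within a single position (`exists_network`).

*Costs.* Consider the sequence `1, v_0, …, v_{n-1}, 0`. Agents in `A` hold a multiple of the sum of
the squared differences over its even links, agents in `B` the same over its odd links, the others
hold `0`. The only minimizer of the sum is the linear ramp from `1` to `0`
(`isSolution_hardCost_iff`), at which all links have length `1 / (n + 1)`, so that the local
gradients there, as well as `R`, have explicit norms.

*Propagation.* A gradient step in `A` makes an even coordinate nonzero only if its predecessor is
already nonzero, and likewise for odd coordinates in `B`. Each new coordinate thus costs one
gradient evaluation and `D` communications: up to time `k (1 + D τ)` all agents have only their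
first `k` coordinates nonzero (`hardCost_reach`). With `k = ⌈T⌉` and `n = max (2 k) 1`, every agent
of one of the two sets still misses `n - k` coordinates, a positive fraction of the chain, and each
of them contributes a multiple of `L / (n + 1) ^ 2` to the Bregman distance
(`le_bregman_hardCost`). As `n + 1` is comparable to `T + 2`, the bounds follow (`rate_bounds`).
-/

namespace DecentralizedOpt

/-! ### Quadratic costs and separable sums -/

section Quadratic

variable {E : Type*} [NormedAddCommGroup E] [InnerProductSpace ℝ E]

/-- The quadratic function `v ↦ ½ ⟪v, H v⟫ - ⟪b, v⟫`. -/
noncomputable def quad (H : E →L[ℝ] E) (b : E) (v : E) : ℝ :=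
  (1 / 2) * ⟪v, H v⟫ - ⟪b, v⟫

variable {H : E →L[ℝ] E} {b : E}

/-- The Bregman distance of a quadratic function is the quadratic form of its Hessian. -/
theorem quad_sub (hH : ∀ v w, ⟪H v, w⟫ = ⟪v, H w⟫) (v w : E) :
    quad H b w - quad H b v - ⟪H v - b, w - v⟫ = (1 / 2) * ⟪w - v, H (w - v)⟫ := by
  have h1 := hH v w
  have h2 : ⟪w, H v⟫ = ⟪H v, w⟫ := real_inner_comm _ _
  have h3 : ⟪H v, v⟫ = ⟪v, H v⟫ := hH v v
  simp only [quad, map_sub, inner_sub_left, inner_sub_right]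
  linarith

theorem hasGradientAt_quad [CompleteSpace E] (hH : ∀ v w, ⟪H v, w⟫ = ⟪v, H w⟫) (v : E) :
    HasGradientAt (quad H b) (H v - b) v := by
  rw [hasGradientAt_iff_hasFDerivAt]
  have h1 : HasFDerivAt (fun v : E => ⟪v, H v⟫) _ v :=
    (hasFDerivAt_id v).inner ℝ H.hasFDerivAt
  have h2 : HasFDerivAt (fun v : E => ⟪b, v⟫) _ v := (innerSL ℝ b).hasFDerivAt
  refine ((h1.const_mul (1 / 2)).sub h2).congr_fderiv ?_
  ext w
  have h3 : inner ℝ w (H v) = inner ℝ (H v) w := real_inner_comm _ _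
  have h4 := hH v w
  simp [fderivInnerCLM_apply]
  linarith

theorem convexOn_quad (hH : ∀ v w, ⟪H v, w⟫ = ⟪v, H w⟫) (hpos : ∀ v, 0 ≤ ⟪v, H v⟫) :
    ConvexOn ℝ Set.univ (quad H b) := by
  refine ⟨convex_univ, fun v _ w _ α β hα hβ hαβ => ?_⟩
  have h1 := hH v w
  have h2 : ⟪w, H v⟫ = ⟪H v, w⟫ := real_inner_comm _ _
  have h := mul_nonneg (mul_nonneg hα hβ) (hpos (v - w))
  obtain rfl : β = 1 - α := by linarith
  simp only [quad, map_sub, map_add, map_smul, inner_sub_left, inner_sub_right, inner_add_left,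
    inner_add_right, real_inner_smul_left, real_inner_smul_right, smul_eq_mul] at h ⊢
  rw [h2, h1] at h ⊢
  nlinarith [h]

theorem isSmooth_quad [CompleteSpace E] (hH : ∀ v w, ⟪H v, w⟫ = ⟪v, H w⟫) {L : ℝ}
    (hL : ∀ v, ‖H v‖ ≤ L * ‖v‖) :
    IsSmooth L (quad H b) := by
  refine ⟨fun v => (hasGradientAt_quad hH v).differentiableAt, fun v w => ?_⟩
  rw [(hasGradientAt_quad hH v).gradient, (hasGradientAt_quad hH w).gradient,
    sub_sub_sub_cancel_right, ← map_sub]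
  exact hL _

end Quadratic

section Stacked

variable {m d : ℕ} {f : Fin m → Vec d → ℝ}

theorem hasGradientAt_stackedCost {g : Fin m → Vec d} {x : Stack m d}
    (hf : ∀ i, HasGradientAt (f i) (g i) (x i)) :
    HasGradientAt (stackedCost f) (WithLp.toLp 2 g : Stack m d) x := by
  rw [hasGradientAt_iff_hasFDerivAt]
  rw [show stackedCost f = fun x => ∑ i, f i (x i) from rfl,
    show InnerProductSpace.toDual ℝ (Stack m d) (WithLp.toLp 2 g) =
      ∑ i, (InnerProductSpace.toDual ℝ (Vec d) (g i)).comp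
        (PiLp.proj 2 (𝕜 := ℝ) (fun _ : Fin m => Vec d) i) by ext y; simp [PiLp.inner_apply]]
  refine HasFDerivAt.fun_sum fun i _ => ?_
  exact (hasGradientAt_iff_hasFDerivAt.1 (hf i)).comp x
      (PiLp.proj 2 (𝕜 := ℝ) (fun _ : Fin m => Vec d) i).hasFDerivAt

theorem isSmooth_stackedCost {L : ℝ} (hL : 0 ≤ L) (hf : ∀ i, IsSmooth L (f i)) :
    IsSmooth L (stackedCost f) := by
  have hg : ∀ x : Stack m d, HasGradientAt (stackedCost f)
      (WithLp.toLp 2 (fun i => gradient (f i) (x i)) : Stack m d) x := fun x =>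
    hasGradientAt_stackedCost fun i => ((hf i).1 (x i)).hasGradientAt
  refine ⟨fun x => (hg x).differentiableAt, fun x y => ?_⟩
  rw [(hg x).gradient, (hg y).gradient]
  refine le_of_sq_le_sq ?_ (by positivity)
  rw [mul_pow, PiLp.norm_sq_eq_of_L2, PiLp.norm_sq_eq_of_L2, Finset.mul_sum]
  refine Finset.sum_le_sum fun i _ => ?_
  rw [← mul_pow]
  exact pow_le_pow_left₀ (norm_nonneg _) ((hf i).2 (x i) (y i)) 2

theorem bregman_eq_sum {g : Fin m → Vec d} (x : Stack m d) {xs : Stack m d}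
    (hf : ∀ i, HasGradientAt (f i) (g i) (xs i)) :
    bregman f x xs = ∑ i, (f i (x i) - f i (xs i) - ⟪g i, x i - xs i⟫) := by
  rw [bregman, (hasGradientAt_stackedCost hf).gradient]
  simp [stackedCost, PiLp.inner_apply, Finset.sum_sub_distrib]

end Stacked

/-! ### Speed of propagation along a gossip network -/

/-- The vectors of `ℝ^d` whose coordinates from the `k`-th on (counted from `0`) vanish. -/
def firstCoords (d k : ℕ) : Submodule ℝ (Vec d) where
  carrier := {v | ∀ j : Fin d, k ≤ j → v j = 0}
  add_mem' hv hw j hj := by simp [hv j hj, hw j hj]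
  zero_mem' j _ := rfl
  smul_mem' a v hv j hj := by simp [hv j hj]

/-- The distance, for an agent at level `l ∈ [0, D]`, to the agents whose gradients can make the
`k`-th coordinate nonzero: they are at level `0` for `k` even and at level `D` for `k` odd. -/
def sourceDist (D k l : ℕ) : ℕ := if k % 2 = 0 then l else D - l

/-- Suppose that local gradients create at most the next coordinate, and create the `k`-th one only
at the agents with `sourceDist D k = 0`. As the sources of consecutive coordinates are `D`
communications apart, an agent has only its first `k` coordinates nonzero until it has had the time
for `k + 1` gradient evaluations, `k` crossings of the network and the way from the sources of the
`k`-th coordinate. -/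
theorem mem_firstCoords_of_le {m d : ℕ} {G : SimpleGraph (Fin m)} {τ : ℝ} (hτ : 0 < τ)
    {f : Fin m → Vec d → ℝ} {x : ℝ → Stack m d} (hx : IsGossipTrajectory G τ f x)
    {D : ℕ} {level : Fin m → ℕ} (hD : ∀ i, level i ≤ D)
    (hadj : ∀ i j, G.Adj i j → level i ≤ level j + 1)
    (hsucc : ∀ i k v, v ∈ firstCoords d k → gradient (f i) v ∈ firstCoords d (k + 1))
    (hstay : ∀ i k v, sourceDist D k (level i) ≠ 0 → v ∈ firstCoords d k →
      gradient (f i) v ∈ firstCoords d k)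
    {t : ℝ} (ht : 0 ≤ t) (i : Fin m) (k : ℕ)
    (htk : t ≤ (k + 1 : ℕ) + (k * D + sourceDist D k (level i) : ℕ) * τ) :
    x t i ∈ firstCoords d k := by
  have hε : 0 < min τ 1 := lt_min hτ one_pos
  -- Information used at time `t` is older than `t - min τ 1`, which allows induction on time.
  have key : ∀ N : ℕ, ∀ t : ℝ, 0 ≤ t → t ≤ N * min τ 1 → ∀ i k,
      t ≤ (k + 1 : ℕ) + (k * D + sourceDist D k (level i) : ℕ) * τ →
      x t i ∈ firstCoords d k := by
    intro N
    induction N with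
    | zero =>
      intro t ht htN i k _
      obtain rfl : t = 0 := le_antisymm (by simpa using htN) ht
      rw [hx.1]
      exact (firstCoords d k).zero_mem
    | succ N ih =>
      intro t ht htN i k htk
      have hN : t - min τ 1 ≤ N * min τ 1 := by push_cast at htN; linarith
      have hmτ : min τ 1 ≤ τ := min_le_left _ _
      have hm1 : min τ 1 ≤ 1 := min_le_right _ _
      refine (sup_le (Submodule.span_le.2 ?_) (Submodule.span_le.2 ?_) :
        _ ≤ firstCoords d k) (hx.2 t ht i)
      · rintro _ ⟨j, hij, s, hs0, hst, rfl⟩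
        refine ih s hs0 (by linarith) j k ?_
        have h1 : sourceDist D k (level i) ≤ sourceDist D k (level j) + 1 := by
          have := hadj i j hij
          have := hadj j i hij.symm
          unfold sourceDist
          split_ifs <;> omega
        have h2 : ((k * D + sourceDist D k (level i) : ℕ) : ℝ) ≤
            (k * D + sourceDist D k (level j) : ℕ) + 1 := by exact_mod_cast (by omega)
        have h3 := mul_le_mul_of_nonneg_right h2 hτ.le
        linarith
      · rintro _ ⟨s, hs0, hst, rfl | rfl⟩
        · exact ih s hs0 (by linarith) i k (by linarith)
        · by_cases hk : sourceDist D k (level i) = 0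
          · rw [hk] at htk
            cases k with
            | zero => norm_num at htk; linarith
            | succ k =>
              -- A source of coordinate `k + 1` is at distance `D` from the sources of coordinate
              -- `k`, so at time `s` it does not have the latter yet.
              refine hsucc i k _ (ih s hs0 (by linarith) i k ?_)
              have h1 : sourceDist D k (level i) = D := by
                have := hD i
                unfold sourceDist at hk ⊢
                split_ifs at hk ⊢ <;> omega
              rw [h1]
              push_cast at htk ⊢
              linarith
          · exact hstay i k _ hk (ih s hs0 (by linarith) i k (by linarith))
  obtain ⟨N, hN⟩ := exists_nat_ge (t / min τ 1)
  exact key N t ht ((div_le_iff₀ hε).1 hN) i k htk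

/-! ### Link costs on a chain of coordinates -/

section Links

/-- The node joined to node `i` by a link of the parity of `s`, where the link `{i, i + 1}` has the
parity of `i`. For `s = 1` the node `0` is its own partner, by truncated subtraction; this value is
never used, as only the nodes `j + 1` carry coordinates. -/
def partner (s i : ℕ) : ℕ := if (i + s) % 2 = 0 then i + 1 else i - 1

/-- The chain `a, v_0, …, v_{n-1}, 0, 0, …` of boundary value `a`: node `0` carries `a` and node
`i + 1` carries the `i`-th coordinate of `v`, replaced by `0` from the index `n` on. -/
def chain (n : ℕ) {d : ℕ} (a : ℝ) (v : Vec d) : ℕ → ℝ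
  | 0 => a
  | i + 1 => if h : i < d ∧ i < n then v ⟨i, h.1⟩ else 0

/-- The matrix exchanging the coordinates, among the first `n`, whose nodes are joined by a link of
the parity of `s`. Coordinates without such a partner are sent to `0`. -/
def swapMatrix (n d s : ℕ) : Matrix (Fin d) (Fin d) ℝ :=
  Matrix.of fun i j => if (i : ℕ) < n ∧ (j : ℕ) < n ∧ (j : ℕ) + 1 = partner s (i + 1) then 1 else 0

/-- The operator of `swapMatrix` on the Euclidean space. -/
noncomputable def swapOp (n d s : ℕ) : Vec d →L[ℝ] Vec d :=
  Matrix.toEuclideanCLM (𝕜 := ℝ) (swapMatrix n d s)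

theorem swapMatrix_comm (n d s : ℕ) (i j : Fin d) :
    swapMatrix n d s i j = swapMatrix n d s j i := by
  simp only [swapMatrix, Matrix.of_apply]
  congr 1
  unfold partner
  apply propext
  split_ifs <;> omega

theorem swapOp_apply (n d s : ℕ) (v : Vec d) (j : Fin d) :
    swapOp n d s v j = if (j : ℕ) < n then chain n 0 v (partner s (j + 1)) else 0 := by
  rw [swapOp, Matrix.ofLp_toEuclideanCLM, Matrix.mulVec, dotProduct]
  simp only [swapMatrix, Matrix.of_apply, ite_mul, one_mul, zero_mul]
  split_ifs with hj
  · rcases hp : partner s (j + 1) with _ | i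
    · simp [chain]
    · by_cases h : i < d ∧ i < n
      · rw [Finset.sum_eq_single ⟨i, h.1⟩]
        · simp [chain, h, hj]
        · intro b _ hb
          rw [if_neg]
          rintro ⟨-, -, h'⟩
          exact hb (Fin.ext (by simpa using h'))
        · simp
      · rw [Finset.sum_eq_zero]
        · simp [chain, h]
        · intro b _
          rw [if_neg]
          rintro ⟨-, h1, h2⟩
          have := b.2
          omega
  · simp [hj]

theorem inner_swapOp_comm (n d s : ℕ) (v w : Vec d) :
    ⟪swapOp n d s v, w⟫ = ⟪v, swapOp n d s w⟫ := by
  rw [real_inner_comm, swapOp, Matrix.inner_toEuclideanCLM, Matrix.inner_toEuclideanCLM,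
    Matrix.dotProduct_mulVec, dotProduct_comm, ← Matrix.mulVec_transpose]
  congr 2
  ext i j
  exact swapMatrix_comm n d s j i

theorem sum_swapMatrix_le (n d s : ℕ) (i : Fin d) : ∑ j, swapMatrix n d s i j ≤ 1 := by
  simp only [swapMatrix, Matrix.of_apply, Finset.sum_boole]
  norm_cast
  refine Finset.card_le_one.2 fun a ha b hb => Fin.ext ?_
  simp only [Finset.mem_filter] at ha hb
  omega

theorem norm_swapOp_le (n d s : ℕ) (v : Vec d) : ‖swapOp n d s v‖ ≤ ‖v‖ := by
  have key : ∀ u w : Vec d, 2 * ⟪u, swapOp n d s w⟫ ≤ ‖u‖ ^ 2 + ‖w‖ ^ 2 := by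
    intro u w
    have h0 : ∀ i j, 0 ≤ swapMatrix n d s i j := by
      intro i j
      simp only [swapMatrix, Matrix.of_apply]
      split_ifs
      all_goals simp
    rw [swapOp, Matrix.inner_toEuclideanCLM, EuclideanSpace.real_norm_sq_eq,
      EuclideanSpace.real_norm_sq_eq]
    calc 2 * (dotProduct u.ofLp ((swapMatrix n d s).mulVec w.ofLp))
        = ∑ i, ∑ j, swapMatrix n d s i j * (2 * u i * w j) := by
          simp only [dotProduct, Matrix.mulVec, Finset.mul_sum]
          exact Finset.sum_congr rfl fun i _ => Finset.sum_congr rfl fun j _ => by ring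
      _ ≤ ∑ i, ∑ j, swapMatrix n d s i j * (u i ^ 2 + w j ^ 2) := by
          gcongr with i _ j _
          · exact h0 i j
          · exact two_mul_le_add_sq _ _
      _ = ∑ i, (∑ j, swapMatrix n d s i j) * u i ^ 2 +
            ∑ j, (∑ i, swapMatrix n d s j i) * w j ^ 2 := by
          simp only [mul_add, Finset.sum_add_distrib, Finset.sum_mul]
          congr 1
          rw [Finset.sum_comm]
          simp only [swapMatrix_comm]
      _ ≤ ∑ i, 1 * u i ^ 2 + ∑ j, 1 * w j ^ 2 := by
          gcongr <;> exact sum_swapMatrix_le _ _ _ _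
      _ = ∑ i, u i ^ 2 + ∑ j, w j ^ 2 := by simp
  -- Pairing `swapOp v` with itself gives `2 ‖swapOp v‖² ≤ ‖swapOp v‖² + ‖v‖²`.
  have h := key (swapOp n d s v) v
  rw [real_inner_self_eq_norm_sq] at h
  exact le_of_sq_le_sq (by linarith) (norm_nonneg _)

/-- The Hessian of `linkCost`. -/
noncomputable def linkHessian (n d : ℕ) (L : ℝ) (s : ℕ) : Vec d →L[ℝ] Vec d :=
  (L / 2) • (ContinuousLinearMap.id ℝ (Vec d) - swapOp n d s)

/-- The linear part of `linkCost`, which comes from the link between the boundary value `1` and the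
coordinate `0`, a link of even parity. -/
noncomputable def linkBias (d : ℕ) (L : ℝ) (s : ℕ) : Vec d :=
  WithLp.toLp 2 fun j => if s = 0 ∧ (j : ℕ) = 0 then L / 2 else 0

/-- Up to an additive constant, `L / 4` times the sum of the squared differences of the chain
`1, v_0, …, v_{n-1}, 0` over the links of the parity of `s`, plus `L / 4` times the squares of the
coordinates from the `n`-th on. The latter make the minimizer unique when `n < d`. -/
noncomputable def linkCost (n d : ℕ) (L : ℝ) (s : ℕ) : Vec d → ℝ :=
  quad (linkHessian n d L s) (linkBias d L s)

theorem linkHessian_apply (n d : ℕ) (L : ℝ) (s : ℕ) (v : Vec d) :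
    linkHessian n d L s v = (L / 2) • (v - swapOp n d s v) := rfl

theorem inner_linkHessian_comm (n d : ℕ) (L : ℝ) (s : ℕ) (v w : Vec d) :
    ⟪linkHessian n d L s v, w⟫ = ⟪v, linkHessian n d L s w⟫ := by
  simp only [linkHessian_apply, inner_smul_left, inner_smul_right, inner_sub_left, inner_sub_right,
    inner_swapOp_comm]
  rfl

/-- This holds for every operator of norm at most `1` in place of `swapOp`. -/
theorem norm_sub_swapOp_sq_le (n d s : ℕ) (v : Vec d) :
    (1 / 2) * ‖v - swapOp n d s v‖ ^ 2 ≤ ⟪v, v - swapOp n d s v⟫ := by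
  have h := pow_le_pow_left₀ (norm_nonneg _) (norm_swapOp_le n d s v) 2
  rw [norm_sub_sq_real, inner_sub_right, real_inner_self_eq_norm_sq]
  linarith

variable {n d : ℕ} {L : ℝ} {s : ℕ}

theorem le_inner_linkHessian (hL : 0 ≤ L) (v : Vec d) :
    L / 4 * ‖v - swapOp n d s v‖ ^ 2 ≤ ⟪v, linkHessian n d L s v⟫ := by
  rw [linkHessian_apply, inner_smul_right]
  nlinarith [norm_sub_swapOp_sq_le n d s v]

theorem convexOn_linkCost (hL : 0 ≤ L) : ConvexOn ℝ Set.univ (linkCost n d L s) :=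
  convexOn_quad (inner_linkHessian_comm n d L s) fun v =>
    le_trans (by positivity) (le_inner_linkHessian hL v)

theorem isSmooth_linkCost (hL : 0 ≤ L) : IsSmooth L (linkCost n d L s) := by
  refine isSmooth_quad (inner_linkHessian_comm n d L s) fun v => ?_
  rw [linkHessian_apply, norm_smul, Real.norm_of_nonneg (by positivity)]
  have h1 := norm_sub_le v (swapOp n d s v)
  have h2 := norm_swapOp_le n d s v
  nlinarith

theorem hasGradientAt_linkCost (v : Vec d) :
    HasGradientAt (linkCost n d L s) (linkHessian n d L s v - linkBias d L s) v :=
  hasGradientAt_quad (inner_linkHessian_comm n d L s) v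

theorem le_linkCost_sub (hL : 0 ≤ L) (v w : Vec d) :
    L / 8 * ‖(w - v) - swapOp n d s (w - v)‖ ^ 2 ≤
      linkCost n d L s w - linkCost n d L s v - ⟪gradient (linkCost n d L s) v, w - v⟫ := by
  rw [(hasGradientAt_linkCost v).gradient, linkCost, quad_sub (inner_linkHessian_comm n d L s)]
  linarith [le_inner_linkHessian (n := n) (s := s) hL (w - v)]

theorem chain_partner (hs : s ≤ 1) (v : Vec d) (j : ℕ) :
    chain n 1 v (partner s (j + 1)) =
      chain n 0 v (partner s (j + 1)) + if s = 0 ∧ j = 0 then 1 else 0 := by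
  rcases hp : partner s (j + 1) with _ | i
  · rw [if_pos (by unfold partner at hp; split_ifs at hp; omega)]
    simp [chain]
  · rw [if_neg (by rintro ⟨rfl, rfl⟩; simp [partner] at hp)]
    simp [chain]

theorem gradient_linkCost_apply (hn : 1 ≤ n) (hs : s ≤ 1) (v : Vec d) (j : Fin d) :
    gradient (linkCost n d L s) v j =
      L / 2 * if (j : ℕ) < n then chain n 1 v (j + 1) - chain n 1 v (partner s (j + 1))
        else v j := by
  rw [(hasGradientAt_linkCost v).gradient, linkHessian_apply]
  simp only [PiLp.sub_apply, PiLp.smul_apply, swapOp_apply, linkBias, smul_eq_mul]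
  split_ifs with hj h0
  · rw [chain_partner hs, if_pos h0]; simp [chain, hj]; ring
  · rw [chain_partner hs, if_neg h0]; simp [chain, hj]
  · omega
  · ring


theorem chain_eq_zero {k : ℕ} {v : Vec d} (hv : v ∈ firstCoords d k) (a : ℝ) {i : ℕ}
    (hi : k < i) : chain n a v i = 0 := by
  cases i with
  | zero => omega
  | succ i =>
    simp only [chain]
    split_ifs with h
    · exact hv ⟨i, h.1⟩ (by simpa using by omega)
    · rfl

/-- The gradient of `linkCost` maps vectors supported on the first `k` coordinates to vectors
supported on the first `l ≥ k` coordinates if no link of the parity of `s` joins the boundary node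
`0` or these `k` coordinates to a coordinate from the `l`-th on. -/
theorem gradient_linkCost_mem (hn : 1 ≤ n) (hs : s ≤ 1) {k l : ℕ} (hkl : k ≤ l) {v : Vec d}
    (hv : v ∈ firstCoords d k) (hp : ∀ j, l ≤ j → k < partner s (j + 1)) :
    gradient (linkCost n d L s) v ∈ firstCoords d l := by
  intro j hj
  rw [gradient_linkCost_apply hn hs, hv j (hkl.trans hj),
    chain_eq_zero hv 1 (show k < (j : ℕ) + 1 by omega), chain_eq_zero hv 1 (hp j hj)]
  simp

theorem lt_partner {k j : ℕ} (hkj : k ≤ j) (h : (k + s) % 2 = 1 ∨ k < j) :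
    k < partner s (j + 1) := by
  unfold partner
  split_ifs <;> omega

/-- The linear interpolation between the boundary values `1` at node `0` and `0` at node `n + 1`,
which is the minimizer of the total cost. -/
noncomputable def ramp (n d : ℕ) : Vec d :=
  WithLp.toLp 2 fun j => if (j : ℕ) < n then 1 - ((j : ℝ) + 1) / (n + 1) else 0

theorem chain_ramp (hnd : n ≤ d) {i : ℕ} (hi : i ≤ n + 1) :
    chain n 1 (ramp n d) i = 1 - (i : ℝ) / (n + 1) := by
  have hn : (n : ℝ) + 1 ≠ 0 := by positivity
  cases i with
  | zero => simp [chain]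
  | succ i =>
    by_cases h : i < n
    · simp [chain, ramp, h, h.trans_le hnd]
    · obtain rfl : i = n := by omega
      simp [chain, hn]

/-- The ramp is the only solution of the discrete Dirichlet problem on the chain. -/
theorem eq_ramp (hnd : n ≤ d) {v : Vec d}
    (hv : ∀ j : Fin d, (j : ℕ) < n →
      2 * chain n 1 v (j + 1) = chain n 1 v j + chain n 1 v (j + 2))
    (hv' : ∀ j : Fin d, n ≤ j → v j = 0) : v = ramp n d := by
  have hn : (n : ℝ) + 1 ≠ 0 := by positivity
  have key : ∀ i, (i ≤ n + 1 → chain n 1 v i = 1 + i * (chain n 1 v 1 - 1)) ∧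
      (i + 1 ≤ n + 1 → chain n 1 v (i + 1) = 1 + (i + 1) * (chain n 1 v 1 - 1)) := by
    intro i
    induction i with
    | zero => simp [chain]
    | succ i ih =>
      refine ⟨fun h => by rw [ih.2 h]; push_cast; ring, fun h => ?_⟩
      have := hv ⟨i, by omega⟩ (by simpa using by omega)
      simp only at this
      rw [ih.1 (by omega), ih.2 (by omega)] at this
      push_cast
      linarith
  have hlast : chain n 1 v (n + 1) = 0 := by simp [chain]
  have h1 : chain n 1 v 1 - 1 = -(1 / (n + 1)) := by
    rw [(key (n + 1)).1 le_rfl] at hlast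
    push_cast at hlast
    field_simp
    linarith
  ext j
  by_cases hj : (j : ℕ) < n
  · have h2 := (key j).2 (by omega)
    rw [h1] at h2
    simp only [chain, Fin.is_lt, hj, and_self, dif_pos] at h2
    simp only [ramp, hj, if_true]
    rw [h2]
    ring
  · simp [ramp, hj, hv' j (by omega)]

theorem gradient_linkCost_ramp_sq (hn : 1 ≤ n) (hs : s ≤ 1) (hnd : n ≤ d) (j : Fin d) :
    gradient (linkCost n d L s) (ramp n d) j ^ 2 =
      if (j : ℕ) < n then (L / 2) ^ 2 * (1 / (n + 1)) ^ 2 else 0 := by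
  rw [gradient_linkCost_apply hn hs]
  split_ifs with hj
  · rw [chain_ramp hnd (by omega), chain_ramp hnd (by unfold partner; split_ifs <;> omega)]
    unfold partner
    split_ifs
    · push_cast; ring
    · rw [Nat.add_sub_cancel]; push_cast; ring
  · simp [ramp, hj]

theorem norm_gradient_linkCost_ramp_sq (hn : 1 ≤ n) (hs : s ≤ 1) (hnd : n ≤ d) :
    ‖gradient (linkCost n d L s) (ramp n d)‖ ^ 2 = n * L ^ 2 / (4 * (n + 1) ^ 2) := by
  rw [EuclideanSpace.real_norm_sq_eq]
  simp only [gradient_linkCost_ramp_sq hn hs hnd]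
  rw [Fin.sum_univ_eq_sum_range
    (fun j => if j < n then (L / 2) ^ 2 * (1 / ((n : ℝ) + 1)) ^ 2 else 0) d,
    ← Finset.sum_filter]
  have : (Finset.range d).filter (· < n) = Finset.range n := by
    ext; simp; omega
  rw [this, Finset.sum_const, Finset.card_range, nsmul_eq_mul]
  field_simp
  norm_num

theorem norm_ramp_sq (hnd : n ≤ d) : ‖ramp n d‖ ^ 2 = n * (2 * n + 1) / (6 * (n + 1)) := by
  have hn : (n : ℝ) + 1 ≠ 0 := by positivity
  rw [EuclideanSpace.real_norm_sq_eq]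
  simp only [ramp, ite_pow]
  rw [Fin.sum_univ_eq_sum_range
    (fun j => if j < n then (1 - ((j : ℝ) + 1) / (n + 1)) ^ 2 else 0 ^ 2) d]
  rw [zero_pow two_ne_zero, ← Finset.sum_filter]
  have : (Finset.range d).filter (· < n) = Finset.range n := by
    ext; simp; omega
  rw [this, ← Finset.sum_range_reflect]
  have h2 : ∀ N : ℕ, ∑ j ∈ Finset.range N, ((j : ℝ) + 1) ^ 2 =
      (N : ℝ) * (N + 1) * (2 * N + 1) / 6 := by
    intro N
    induction N with
    | zero => simp
    | succ N ih => rw [Finset.sum_range_succ, ih]; push_cast; ring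
  calc ∑ j ∈ Finset.range n, (1 - (((n - 1 - j : ℕ) : ℝ) + 1) / (n + 1)) ^ 2
      = ∑ j ∈ Finset.range n, ((j : ℝ) + 1) ^ 2 / (n + 1) ^ 2 := by
        refine Finset.sum_congr rfl fun j hj => ?_
        rw [Finset.mem_range] at hj
        rw [Nat.cast_sub (by omega), Nat.cast_sub (by omega)]
        field_simp
        push_cast
        ring
    _ = _ := by
        rw [← Finset.sum_div, h2]
        field_simp

/-- If the links of the parity of `s` do not join coordinate `k` to its predecessor, then each of
the `n - k` coordinates missed by `v` sits on a link on which `v - ramp` has the difference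
`± 1 / (n + 1)`. -/
theorem le_linkCost_sub_ramp (hL : 0 ≤ L) (hnd : n ≤ d) {k : ℕ} (hk : (k + s) % 2 = 1)
    (hkn : k ≤ n) {v : Vec d} (hv : v ∈ firstCoords d k) :
    L * (n - k) / (8 * (n + 1) ^ 2) ≤ linkCost n d L s v - linkCost n d L s (ramp n d) -
      ⟪gradient (linkCost n d L s) (ramp n d), v - ramp n d⟫ := by
  refine le_trans ?_ (le_linkCost_sub hL _ _)
  have hch : ∀ i, k < i → i ≤ n + 1 → chain n 0 (v - ramp n d) i = -(1 - (i : ℝ) / (n + 1)) := by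
    intro i hi hin
    rw [← chain_ramp hnd hin]
    cases i with
    | zero => omega
    | succ i =>
      simp only [chain]
      split_ifs with h
      · have := hv ⟨i, h.1⟩ (by simpa using by omega)
        simp [this]
      · simp
  have hterm : ∀ j : Fin d, (if k ≤ (j : ℕ) ∧ (j : ℕ) < n then (1 / ((n : ℝ) + 1)) ^ 2 else 0) ≤
      ((v - ramp n d) - swapOp n d s (v - ramp n d)) j ^ 2 := by
    intro j
    split_ifs with hj
    · have h1 : (v - ramp n d) j = chain n 0 (v - ramp n d) (j + 1) := by simp [chain, hj.2]
      have h2 : k < partner s (j + 1) := lt_partner hj.1 (Or.inl hk)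
      rw [PiLp.sub_apply, swapOp_apply, if_pos hj.2, h1, hch _ (by omega) (by omega),
        hch _ h2 (by unfold partner; split_ifs <;> omega)]
      refine le_of_eq ?_
      unfold partner
      split_ifs
      · push_cast; ring
      · rw [Nat.add_sub_cancel]; push_cast; ring
    · positivity
  rw [EuclideanSpace.real_norm_sq_eq]
  have h := Finset.sum_le_sum fun j (_ : j ∈ (Finset.univ : Finset (Fin d))) => hterm j
  rw [Fin.sum_univ_eq_sum_range
    (fun j => if k ≤ j ∧ j < n then (1 / ((n : ℝ) + 1)) ^ 2 else 0) d, ← Finset.sum_filter] at h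
  have hfil : (Finset.range d).filter (fun j => k ≤ j ∧ j < n) = Finset.Ico k n := by
    ext; simp; omega
  rw [hfil, Finset.sum_const, Nat.card_Ico, nsmul_eq_mul, Nat.cast_sub hkn] at h
  refine le_trans (le_of_eq ?_) (mul_le_mul_of_nonneg_left h (by positivity : 0 ≤ L / 8))
  field_simp

end Links

/-! ### Spectrum of a gossip matrix -/

section Spectrum

open Matrix

/-- A positive semidefinite matrix induced by `G` that annihilates the all-ones vector, has
eigenvalues `a > 0` and `b`, and satisfies `a ≤ W ≤ b` on the orthogonal complement of the all-ones
vector, is a gossip matrix of eigengap `a / b`. -/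
theorem isGossipMatrix_eigengap {m : ℕ} (hm : 2 ≤ m) {G : SimpleGraph (Fin m)}
    {W : Matrix (Fin m) (Fin m) ℝ} (hind : ∀ i j, W i j ≠ 0 → i = j ∨ G.Adj i j)
    (hW : W.PosSemidef) (hone : W *ᵥ (fun _ => 1) = 0) {a b : ℝ} (ha : 0 < a)
    {v w : Fin m → ℝ} (hv : W *ᵥ v = a • v) (hv0 : v ≠ 0) (hw : W *ᵥ w = b • w) (hw0 : w ≠ 0)
    (hlow : ∀ x : Fin m → ℝ, ∑ i, x i = 0 → a * (x ⬝ᵥ x) ≤ x ⬝ᵥ (W *ᵥ x))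
    (hup : ∀ x : Fin m → ℝ, x ⬝ᵥ (W *ᵥ x) ≤ b * (x ⬝ᵥ x)) :
    ∃ hW' : IsGossipMatrix G W, eigengap hm hW'.posSemidef.isHermitian = a / b := by
  have hker : ∀ x : Fin m → ℝ, W *ᵥ x = 0 → ∃ c : ℝ, x = fun _ => c := by
    intro x hx
    have hm0 : (m : ℝ) ≠ 0 := by positivity
    set c : ℝ := (∑ i, x i) / m
    refine ⟨c, ?_⟩
    have h1 := hlow (x - fun _ => c) (by simp [c]; field_simp; ring)
    have h2 : W *ᵥ (x - fun _ => c) = 0 := by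
      have : (fun _ : Fin m => c) = c • fun _ => (1 : ℝ) := by ext; simp
      rw [mulVec_sub, hx, this, mulVec_smul, hone, smul_zero, sub_zero]
    rw [h2, dotProduct_zero] at h1
    have h3 : (x - fun _ => c) ⬝ᵥ (x - fun _ => c) = 0 :=
      le_antisymm (by nlinarith) (Finset.sum_nonneg fun i _ => mul_self_nonneg _)
    exact sub_eq_zero.1 (dotProduct_self_eq_zero.1 h3)
  have hWg : IsGossipMatrix G W := by
    refine ⟨hind, hW, le_antisymm (fun x hx => ?_) ?_⟩
    · obtain ⟨c, rfl⟩ := hker x (by simpa using hx)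
      exact Submodule.mem_span_singleton.2 ⟨c, by ext; simp⟩
    · rw [Submodule.span_singleton_le_iff_mem]
      simpa using hone
  refine ⟨hWg, ?_⟩
  have hH := hWg.posSemidef.isHermitian
  change eigengap hm hH = a / b
  have hev : ∀ {μ : ℝ} {x : Fin m → ℝ}, x ≠ 0 → W *ᵥ x = μ • x → ∃ k, hH.eigenvalues₀ k = μ := by
    intro μ x hx0 hx
    have h1 : μ ∈ spectrum ℝ W := by
      rw [← Matrix.spectrum_toLin', ← Module.End.hasEigenvalue_iff_mem_spectrum]
      exact Module.End.hasEigenvalue_of_hasEigenvector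
        (x := x) ⟨Module.End.mem_eigenspace_iff.2 (by simpa using hx), hx0⟩
    rw [hH.spectrum_real_eq_range_eigenvalues] at h1
    obtain ⟨i, hi⟩ := h1
    exact ⟨_, hi⟩
  let σ := (Fintype.equivOfCardEq (Fintype.card_fin _) : Fin (Fintype.card (Fin m)) ≃ Fin m)
  have hσ : ∀ k, hH.eigenvalues₀ k = hH.eigenvalues (σ k) := by
    intro k; simp [IsHermitian.eigenvalues, σ]
  have hquad : ∀ k, ∃ x : Fin m → ℝ, x ≠ 0 ∧ W *ᵥ x = hH.eigenvalues₀ k • x := by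
    intro k
    refine ⟨hH.eigenvectorBasis (σ k), ?_, ?_⟩
    · intro h0
      exact hH.eigenvectorBasis.toBasis.ne_zero (σ k) (by ext i; simpa using congrFun h0 i)
    · rw [hσ]; exact hH.mulVec_eigenvectorBasis (σ k)
  have hpos : ∀ {x : Fin m → ℝ}, x ≠ 0 → 0 < x ⬝ᵥ x := fun {x} hx =>
    lt_of_le_of_ne (Finset.sum_nonneg fun i _ => mul_self_nonneg _)
      (Ne.symm fun h => hx (dotProduct_self_eq_zero.1 h))
  have hle : ∀ k, hH.eigenvalues₀ k ≤ b := by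
    intro k
    obtain ⟨x, hx0, hx⟩ := hquad k
    have h := hup x
    rw [hx, dotProduct_smul, smul_eq_mul] at h
    exact le_of_mul_le_mul_right h (hpos hx0)
  have hge : ∀ k, hH.eigenvalues₀ k ≠ 0 → a ≤ hH.eigenvalues₀ k := by
    intro k hk
    obtain ⟨x, hx0, hx⟩ := hquad k
    have hsum : ∑ i, x i = 0 := by
      have h1 : (fun _ => (1 : ℝ)) ⬝ᵥ (W *ᵥ x) = 0 := by
        have hT : Wᵀ = W := by simpa [IsHermitian, conjTranspose_eq_transpose_of_trivial] using hH
        rw [dotProduct_mulVec, ← mulVec_transpose, hT, hone, zero_dotProduct]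
      rw [hx, dotProduct_smul, smul_eq_mul] at h1
      simpa [dotProduct] using (mul_eq_zero.1 h1).resolve_left hk
    have h := hlow x hsum
    rw [hx, dotProduct_smul, smul_eq_mul] at h
    exact le_of_mul_le_mul_right h (hpos hx0)
  have hcard : Fintype.card (Fin m) = m := Fintype.card_fin m
  have hanti := hH.eigenvalues₀_antitone
  have htop : hH.eigenvalues₀ ⟨0, by omega⟩ = b := by
    obtain ⟨k, hk⟩ := hev hw0 hw
    refine le_antisymm (hle _) (hk ▸ hanti ?_)
    exact Fin.mk_le_mk.2 (Nat.zero_le _)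
  have hnonneg : ∀ k, 0 ≤ hH.eigenvalues₀ k := fun k => by
    rw [hσ]; exact hW.eigenvalues_nonneg _
  have hlast : ∀ k : Fin (Fintype.card (Fin m)), (k : ℕ) = m - 1 → hH.eigenvalues₀ k = 0 := by
    intro k hk
    obtain ⟨l, hl⟩ := hev (μ := 0) (x := fun _ => 1)
      (fun h => one_ne_zero (congrFun h ⟨0, by omega⟩)) (by rw [hone, zero_smul])
    have hlk : l ≤ k := Fin.mk_le_mk.2 (by have := l.2; omega)
    exact le_antisymm ((hanti hlk).trans hl.le) (hnonneg k)
  -- The kernel has dimension one, so `0` is not attained at the index `m - 2`: two orthonormal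
  -- eigenvectors in the kernel would both be constant.
  have hne : hH.eigenvalues₀ ⟨m - 2, by omega⟩ ≠ 0 := by
    intro h0
    have h1 := hlast ⟨m - 1, by omega⟩ rfl
    rw [hσ] at h0 h1
    have e0 := hH.mulVec_eigenvectorBasis (σ ⟨m - 2, by omega⟩)
    have e1 := hH.mulVec_eigenvectorBasis (σ ⟨m - 1, by omega⟩)
    rw [h0, zero_smul] at e0
    rw [h1, zero_smul] at e1
    obtain ⟨c, hc⟩ := hker _ e0
    obtain ⟨c', hc'⟩ := hker _ e1
    have horth := hH.eigenvectorBasis.orthonormal.2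
      (show σ ⟨m - 2, by omega⟩ ≠ σ ⟨m - 1, by omega⟩ by
        intro h; have := congrArg Fin.val (σ.injective h); simp at this; omega)
    have n0 := hH.eigenvectorBasis.orthonormal.1 (σ ⟨m - 2, by omega⟩)
    have n1 := hH.eigenvectorBasis.orthonormal.1 (σ ⟨m - 1, by omega⟩)
    rw [EuclideanSpace.norm_eq, Real.sqrt_eq_one] at n0 n1
    simp only [PiLp.inner_apply] at horth
    simp only [hc, hc'] at horth n0 n1
    simp at horth n0 n1
    rcases horth with h | h | h
    · omega
    · simp [h] at n1
    · simp [h] at n0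
  have hsecond : hH.eigenvalues₀ ⟨m - 2, by omega⟩ = a := by
    obtain ⟨k, hk⟩ := hev hv0 hv
    refine le_antisymm (hk ▸ hanti ?_) (hge _ hne)
    refine Fin.mk_le_mk.2 ?_
    have : (k : ℕ) ≠ m - 1 := fun h => ha.ne' (hk ▸ hlast k h)
    have := k.2
    omega
  rw [eigengap, hsecond, htop]

end Spectrum

/-! ### A thickened path with prescribed eigengap -/

section Network

open Matrix

/-- A Poincaré inequality on the path with `M + 1` nodes. The constant comes from comparing with the
value at the first node, and is of the optimal order `M ^ 2`. -/
theorem sum_sq_le_mul_sum_sq_sub (S : ℕ → ℝ) (M : ℕ) (hS : ∑ p ∈ Finset.range (M + 1), S p = 0) :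
    ∑ p ∈ Finset.range (M + 1), S p ^ 2 ≤
      (M + 1) * M / 2 * ∑ p ∈ Finset.range M, (S (p + 1) - S p) ^ 2 := by
  have h1 : ∑ p ∈ Finset.range (M + 1), S p ^ 2 ≤
      ∑ p ∈ Finset.range (M + 1), (S p - S 0) ^ 2 := by
    have : ∑ p ∈ Finset.range (M + 1), (S p - S 0) ^ 2 =
        ∑ p ∈ Finset.range (M + 1), S p ^ 2 - 2 * S 0 * ∑ p ∈ Finset.range (M + 1), S p +
          (M + 1) * S 0 ^ 2 := by
      rw [Finset.mul_sum, ← Finset.sum_sub_distrib]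
      have h : ((M : ℝ) + 1) * S 0 ^ 2 = ∑ p ∈ Finset.range (M + 1), S 0 ^ 2 := by simp
      rw [h, ← Finset.sum_add_distrib]
      exact Finset.sum_congr rfl fun p _ => by ring
    rw [this, hS]
    have : 0 ≤ ((M : ℝ) + 1) * S 0 ^ 2 := by positivity
    linarith
  refine h1.trans ?_
  have h2 : ∀ p ∈ Finset.range (M + 1), (S p - S 0) ^ 2 ≤
      p * ∑ p ∈ Finset.range M, (S (p + 1) - S p) ^ 2 := by
    intro p hp
    rw [← Finset.sum_range_sub]
    refine sq_sum_le_card_mul_sum_sq.trans ?_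
    rw [Finset.card_range]
    gcongr
    have := Finset.mem_range.1 hp
    omega
  refine (Finset.sum_le_sum h2).trans (le_of_eq ?_)
  rw [← Finset.sum_mul]
  congr 1
  have h3 : (∑ p ∈ Finset.range (M + 1), p) * 2 = (M + 1) * M :=
    Finset.sum_range_id_mul_two (M + 1)
  have h4 := congrArg (Nat.cast : ℕ → ℝ) h3
  push_cast at h4
  linarith

/-- The position of an agent on the path. The agents are indexed by pairs (position, copy). -/
def pos {M : ℕ} (i : Fin ((M + 1) * 3)) : ℕ := (finProdFinEquiv.symm i).1

/-- The index of an agent among the three copies at its position. -/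
def copy {M : ℕ} (i : Fin ((M + 1) * 3)) : Fin 3 := (finProdFinEquiv.symm i).2

/-- The agent with a given position and copy. -/
def agent {M : ℕ} (p : ℕ) (hp : p < M + 1) (a : Fin 3) : Fin ((M + 1) * 3) :=
  finProdFinEquiv (⟨p, hp⟩, a)

variable {M : ℕ}

theorem pos_lt (i : Fin ((M + 1) * 3)) : pos i < M + 1 := (finProdFinEquiv.symm i).1.2

@[simp] theorem pos_agent (p : ℕ) (hp : p < M + 1) (a : Fin 3) : pos (agent p hp a) = p := by
  simp [pos, agent]

@[simp] theorem copy_agent (p : ℕ) (hp : p < M + 1) (a : Fin 3) : copy (agent p hp a) = a := by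
  simp [copy, agent]

theorem agent_pos_copy (i : Fin ((M + 1) * 3)) : agent (pos i) (pos_lt i) (copy i) = i :=
  finProdFinEquiv.apply_symm_apply i

theorem sum_agents {R : Type*} [AddCommMonoid R] (F : ℕ → Fin 3 → R) :
    ∑ i : Fin ((M + 1) * 3), F (pos i) (copy i) =
      ∑ p ∈ Finset.range (M + 1), (F p 0 + F p 1 + F p 2) := by
  rw [← finProdFinEquiv.sum_comp, Fintype.sum_prod_type]
  simp only [pos, copy, Equiv.symm_apply_apply, Fin.sum_univ_three]
  exact Fin.sum_univ_eq_sum_range (fun p => F p 0 + F p 1 + F p 2) (M + 1)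

/-- A vector as a function of position and copy, extended by `0` beyond the last position. -/
def entry (x : Fin ((M + 1) * 3) → ℝ) (p : ℕ) (a : Fin 3) : ℝ :=
  if h : p < M + 1 then x (agent p h a) else 0

theorem entry_pos_copy (x : Fin ((M + 1) * 3) → ℝ) (i) : entry x (pos i) (copy i) = x i := by
  rw [entry, dif_pos (pos_lt i), agent_pos_copy]

theorem sum_mul_agents (F : ℕ → Fin 3 → ℝ) (x : Fin ((M + 1) * 3) → ℝ) :
    (fun i => F (pos i) (copy i)) ⬝ᵥ x = ∑ p ∈ Finset.range (M + 1),
      (F p 0 * entry x p 0 + F p 1 * entry x p 1 + F p 2 * entry x p 2) := by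
  rw [← sum_agents (M := M) (fun p a => F p a * entry x p a)]
  simp only [dotProduct, entry_pos_copy]

/-- The vector whose product with `x` is the increment of `fibreSum x` from `p` to `p + 1`. -/
def jump (p : ℕ) (i : Fin ((M + 1) * 3)) : ℝ :=
  (if pos i = p + 1 then 1 else 0) - (if pos i = p then 1 else 0)

/-- The vector with values `α` on the three copies at position `p`, and `0` elsewhere. -/
def contrast (α : Fin 3 → ℝ) (p : ℕ) (i : Fin ((M + 1) * 3)) : ℝ :=
  if pos i = p then α (copy i) else 0

/-- The sum of the entries of a vector over the three copies at a position. -/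
def fibreSum (x : Fin ((M + 1) * 3) → ℝ) (p : ℕ) : ℝ := entry x p 0 + entry x p 1 + entry x p 2

theorem jump_dotProduct {p : ℕ} (hp : p < M) (x : Fin ((M + 1) * 3) → ℝ) :
    jump p ⬝ᵥ x = fibreSum x (p + 1) - fibreSum x p := by
  have h := sum_mul_agents
    (fun q _ => (if q = p + 1 then 1 else 0) - (if q = p then 1 else 0)) x
  refine Eq.trans h ?_
  simp only [sub_mul, ite_mul, one_mul, zero_mul, Finset.sum_sub_distrib, Finset.sum_add_distrib,
    Finset.sum_ite_eq', Finset.mem_range]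
  simp only [if_pos (show p + 1 < M + 1 by omega), if_pos (show p < M + 1 by omega), fibreSum]
  ring

theorem contrast_dotProduct (α : Fin 3 → ℝ) {p : ℕ} (hp : p < M + 1)
    (x : Fin ((M + 1) * 3) → ℝ) :
    contrast α p ⬝ᵥ x = α 0 * entry x p 0 + α 1 * entry x p 1 + α 2 * entry x p 2 := by
  have h := sum_mul_agents (fun q a => if q = p then α a else 0) x
  refine Eq.trans h ?_
  rw [Finset.sum_eq_single p]
  · simp
  · intro q _ hq; simp [hq]
  · simp [hp]

theorem entry_contrast (α : Fin 3 → ℝ) {p q : ℕ} (hq : q < M + 1) (a : Fin 3) :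
    entry (contrast (M := M) α p) q a = if q = p then α a else 0 := by
  rw [entry, dif_pos hq]
  simp [contrast]

/-- A gossip matrix on the thickened path: the path Laplacian on the sums over the copies, plus two
orthogonal contrasts at each position, with eigenvalues `η` and `1`. The factor `1 / 12` is the
largest for which the Laplacian part is at most `1` for every `M`; the norms of the contrasts
account for `1 / 2` and `1 / 6`. -/
noncomputable def gossip (M : ℕ) (η : ℝ) :
    Matrix (Fin ((M + 1) * 3)) (Fin ((M + 1) * 3)) ℝ :=
  ∑ p ∈ Finset.range M, (1 / 12 : ℝ) • vecMulVec (jump p) (jump p) +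
    ∑ p ∈ Finset.range (M + 1),
      ((η / 2) • vecMulVec (contrast ![1, -1, 0] p) (contrast ![1, -1, 0] p) +
        (1 / 6 : ℝ) • vecMulVec (contrast ![1, 1, -2] p) (contrast ![1, 1, -2] p))

theorem gossip_mulVec (η : ℝ) (x : Fin ((M + 1) * 3) → ℝ) :
    gossip M η *ᵥ x =
      ∑ p ∈ Finset.range M, (1 / 12 * (fibreSum x (p + 1) - fibreSum x p)) • jump p +
      ∑ p ∈ Finset.range (M + 1),
        ((η / 2 * (entry x p 0 - entry x p 1)) • contrast ![1, -1, 0] p +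
          (1 / 6 * (entry x p 0 + entry x p 1 - 2 * entry x p 2)) • contrast ![1, 1, -2] p) := by
  have hv : ∀ (c : ℝ) (u : Fin ((M + 1) * 3) → ℝ),
      (c • vecMulVec u u) *ᵥ x = (c * (u ⬝ᵥ x)) • u := by
    intro c u
    rw [smul_mulVec, vecMulVec_mulVec, mul_smul]
    ext; simp [mul_comm]
  rw [gossip, add_mulVec, sum_mulVec, sum_mulVec]
  congr 1
  · refine Finset.sum_congr rfl fun p hp => ?_
    rw [hv, jump_dotProduct (Finset.mem_range.1 hp)]
  · refine Finset.sum_congr rfl fun p hp => ?_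
    rw [add_mulVec, hv, hv, contrast_dotProduct _ (Finset.mem_range.1 hp),
      contrast_dotProduct _ (Finset.mem_range.1 hp)]
    simp
    ring_nf

theorem dotProduct_gossip_mulVec (η : ℝ) (x : Fin ((M + 1) * 3) → ℝ) :
    x ⬝ᵥ gossip M η *ᵥ x =
      ∑ p ∈ Finset.range M, 1 / 12 * (fibreSum x (p + 1) - fibreSum x p) ^ 2 +
      ∑ p ∈ Finset.range (M + 1), (η / 2 * (entry x p 0 - entry x p 1) ^ 2 +
          1 / 6 * (entry x p 0 + entry x p 1 - 2 * entry x p 2) ^ 2) := by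
  rw [gossip_mulVec, dotProduct_add, dotProduct_sum, dotProduct_sum]
  congr 1
  · refine Finset.sum_congr rfl fun p hp => ?_
    rw [dotProduct_smul, dotProduct_comm, jump_dotProduct (Finset.mem_range.1 hp), smul_eq_mul]
    ring
  · refine Finset.sum_congr rfl fun p hp => ?_
    rw [dotProduct_add, dotProduct_smul, dotProduct_smul, dotProduct_comm,
      contrast_dotProduct _ (Finset.mem_range.1 hp), dotProduct_comm x,
      contrast_dotProduct _ (Finset.mem_range.1 hp)]
    simp
    ring

theorem dotProduct_self_agents (x : Fin ((M + 1) * 3) → ℝ) :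
    x ⬝ᵥ x = ∑ p ∈ Finset.range (M + 1),
      (entry x p 0 ^ 2 + entry x p 1 ^ 2 + entry x p 2 ^ 2) := by
  rw [← sum_agents (M := M) (fun p a => entry x p a ^ 2)]
  simp only [dotProduct, entry_pos_copy, sq]

theorem sum_fibreSum (x : Fin ((M + 1) * 3) → ℝ) :
    ∑ p ∈ Finset.range (M + 1), fibreSum x p = ∑ i, x i := by
  have h := sum_agents (M := M) (fun p a => entry x p a)
  simp only [entry_pos_copy] at h
  exact h.symm

theorem le_dotProduct_gossip_mulVec {η : ℝ} (hη : 0 ≤ η) (hη1 : η ≤ 1)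
    (hM : η * ((M + 1) * M) ≤ 1 / 2)
    (x : Fin ((M + 1) * 3) → ℝ) (hx : ∑ i, x i = 0) :
    η * (x ⬝ᵥ x) ≤ x ⬝ᵥ gossip M η *ᵥ x := by
  rw [dotProduct_gossip_mulVec, dotProduct_self_agents]
  have h1 := sum_sq_le_mul_sum_sq_sub (fibreSum x) M (by rw [sum_fibreSum, hx])
  set E := ∑ p ∈ Finset.range M, (fibreSum x (p + 1) - fibreSum x p) ^ 2 with hE
  have hE0 : 0 ≤ E := Finset.sum_nonneg fun p _ => sq_nonneg _
  have h2 : η / 3 * ∑ p ∈ Finset.range (M + 1), fibreSum x p ^ 2 ≤ 1 / 12 * E :=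
    calc _ ≤ η / 3 * ((M + 1) * M / 2 * E) := by gcongr
      _ = (η * ((M + 1) * M)) / 6 * E := by ring
      _ ≤ (1 / 2) / 6 * E := by gcongr
      _ = 1 / 12 * E := by ring
  rw [← Finset.mul_sum, ← hE]
  refine le_trans ?_ (add_le_add_left h2 _)
  rw [Finset.mul_sum, Finset.mul_sum, ← Finset.sum_add_distrib]
  refine Finset.sum_le_sum fun p _ => ?_
  have := mul_le_mul_of_nonneg_right hη1 (sq_nonneg (entry x p 0 + entry x p 1 - 2 * entry x p 2))
  simp only [fibreSum]
  linarith

theorem dotProduct_gossip_mulVec_le {η : ℝ} (hη1 : η ≤ 1) (x : Fin ((M + 1) * 3) → ℝ) :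
    x ⬝ᵥ gossip M η *ᵥ x ≤ 1 * (x ⬝ᵥ x) := by
  rw [dotProduct_gossip_mulVec, dotProduct_self_agents]
  have h0 : ∑ p ∈ Finset.range M, fibreSum x p ^ 2 ≤
      ∑ p ∈ Finset.range (M + 1), fibreSum x p ^ 2 := by
    rw [Finset.sum_range_succ]
    linarith [sq_nonneg (fibreSum x M)]
  have h0' : ∑ p ∈ Finset.range M, fibreSum x (p + 1) ^ 2 ≤
      ∑ p ∈ Finset.range (M + 1), fibreSum x p ^ 2 := by
    rw [Finset.sum_range_succ']
    linarith [sq_nonneg (fibreSum x 0)]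
  have h1 : ∑ p ∈ Finset.range M, 1 / 12 * (fibreSum x (p + 1) - fibreSum x p) ^ 2 ≤
      ∑ p ∈ Finset.range (M + 1), 1 / 3 * fibreSum x p ^ 2 := by
    calc _ ≤ ∑ p ∈ Finset.range M, (1 / 6 * fibreSum x (p + 1) ^ 2 + 1 / 6 * fibreSum x p ^ 2) := by
          refine Finset.sum_le_sum fun p _ => ?_
          nlinarith [sq_nonneg (fibreSum x (p + 1) + fibreSum x p)]
      _ ≤ _ := by
          rw [Finset.sum_add_distrib, ← Finset.mul_sum, ← Finset.mul_sum, ← Finset.mul_sum]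
          linarith
  refine (add_le_add_left h1 _).trans ?_
  rw [one_mul, ← Finset.sum_add_distrib]
  refine Finset.sum_le_sum fun p _ => ?_
  have := mul_le_mul_of_nonneg_right hη1 (sq_nonneg (entry x p 0 - entry x p 1))
  simp only [fibreSum]
  linarith

theorem gossip_posSemidef {η : ℝ} (hη : 0 ≤ η) : (gossip M η).PosSemidef := by
  have h : ∀ (c : ℝ) (u : Fin ((M + 1) * 3) → ℝ), 0 ≤ c → (c • vecMulVec u u).PosSemidef := by
    intro c u hc
    refine PosSemidef.smul ?_ hc
    simpa using posSemidef_vecMulVec_self_star u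
  refine PosSemidef.add (posSemidef_sum _ fun p _ => h _ _ (by norm_num))
    (posSemidef_sum _ fun p _ => (h _ _ (by positivity)).add (h _ _ (by norm_num)))

theorem gossip_mulVec_one (η : ℝ) : gossip M η *ᵥ (fun _ => 1) = 0 := by
  have he : ∀ p < M + 1, ∀ a, entry (fun _ : Fin ((M + 1) * 3) => (1 : ℝ)) p a = 1 := by
    intro p hp a
    rw [entry, dif_pos hp]
  rw [gossip_mulVec, Finset.sum_eq_zero, Finset.sum_eq_zero, add_zero]
  · intro p hp
    have hp := Finset.mem_range.1 hp
    norm_num [he p hp]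
  · intro p hp
    have hp := Finset.mem_range.1 hp
    norm_num [fibreSum, he p (by omega), he (p + 1) (by omega)]

/-- A contrast at the position `0` is an eigenvector if its restriction to the three copies is
one. -/
theorem gossip_mulVec_contrast (η : ℝ) {α : Fin 3 → ℝ} {c : ℝ} (hα : α 0 + α 1 + α 2 = 0)
    (h : (η / 2 * (α 0 - α 1)) • ![1, -1, 0] + (1 / 6 * (α 0 + α 1 - 2 * α 2)) • ![1, 1, -2] =
      c • α) :
    gossip M η *ᵥ contrast α 0 = c • contrast α 0 := by
  have hS : ∀ p < M + 1, fibreSum (contrast (M := M) α 0) p = 0 := by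
    intro p hp
    simp only [fibreSum, entry_contrast α hp]
    split_ifs <;> simp [hα]
  rw [gossip_mulVec, Finset.sum_eq_zero, zero_add, Finset.sum_eq_single 0]
  · simp only [entry_contrast α (Nat.succ_pos M), if_true]
    ext i
    have := congrFun h (copy i)
    simp only [Pi.add_apply, Pi.smul_apply, smul_eq_mul, contrast] at this ⊢
    split_ifs
    · exact this
    · simp
  · intro p hp hp0
    simp [entry_contrast α (Finset.mem_range.1 hp), hp0]
  · simp
  · intro p hp
    have hp := Finset.mem_range.1 hp
    simp [hS p (by omega), hS (p + 1) (by omega)]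

theorem contrast_ne_zero {α : Fin 3 → ℝ} (hα : α 0 ≠ 0) : contrast (M := M) α 0 ≠ 0 := by
  intro h
  have := congrFun h (agent 0 (Nat.succ_pos M) 0)
  simp [contrast, hα] at this

/-- The graph joining distinct agents whose positions differ by at most one. -/
def thickPath (M : ℕ) : SimpleGraph (Fin ((M + 1) * 3)) where
  Adj i j := i ≠ j ∧ pos i ≤ pos j + 1 ∧ pos j ≤ pos i + 1
  symm := ⟨fun _ _ h => ⟨h.1.symm, h.2.2, h.2.1⟩⟩
  loopless := ⟨fun _ h => h.1 rfl⟩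

theorem thickPath_connected (M : ℕ) : (thickPath M).Connected := by
  set z := agent 0 (Nat.succ_pos M) 0 with hz
  have key : ∀ p : ℕ, ∀ i : Fin ((M + 1) * 3), pos i = p → (thickPath M).Reachable i z := by
    intro p
    induction p with
    | zero =>
      intro i hi
      by_cases h : i = z
      · rw [h]
      · exact SimpleGraph.Adj.reachable ⟨h, by rw [hi]; omega, by rw [hz, pos_agent]; omega⟩
    | succ p ih =>
      intro i hi
      have hp : p < M + 1 := by have := pos_lt i; omega
      refine SimpleGraph.Reachable.trans (SimpleGraph.Adj.reachable
        (v := agent p hp 0) ⟨?_, ?_, ?_⟩) (ih _ (pos_agent p hp 0))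
      · intro h; rw [h, pos_agent] at hi; omega
      · rw [pos_agent]; omega
      · rw [pos_agent]; omega
  have : Nonempty (Fin ((M + 1) * 3)) := ⟨z⟩
  exact ⟨fun i j => (key _ i rfl).trans (key _ j rfl).symm⟩

theorem gossip_induced (η : ℝ) (i j : Fin ((M + 1) * 3)) (h : gossip M η i j ≠ 0) :
    i = j ∨ (thickPath M).Adj i j := by
  by_contra hcon
  push Not at hcon
  have hfar : pos j + 1 < pos i ∨ pos i + 1 < pos j := by
    by_contra h'
    exact hcon.2 ⟨hcon.1, by omega, by omega⟩
  have h1 : ∀ p, jump p i * jump p j = 0 := by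
    intro p
    unfold jump
    split_ifs <;> first | omega | simp
  have h2 : ∀ α p, contrast α p i * contrast α p j = 0 := by
    intro α p
    unfold contrast
    split_ifs <;> first | omega | simp
  apply h
  simp [gossip, Matrix.sum_apply, vecMulVec_apply, h1, h2]

theorem exists_isGossipMatrix_gossip {η : ℝ} (hη : 0 < η) (hη1 : η ≤ 1)
    (hM : η * ((M + 1) * M) ≤ 1 / 2) (hm : 2 ≤ (M + 1) * 3) :
    ∃ hW : IsGossipMatrix (thickPath M) (gossip M η),
      eigengap hm hW.posSemidef.isHermitian = η := by
  have h := isGossipMatrix_eigengap hm (gossip_induced η) (gossip_posSemidef hη.le)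
    (gossip_mulVec_one η) hη (b := 1)
    (gossip_mulVec_contrast η (α := ![1, -1, 0]) (c := η) (by simp)
      (by ext i; fin_cases i <;> simp <;> ring))
    (contrast_ne_zero (by simp))
    (gossip_mulVec_contrast η (α := ![1, 1, -2]) (c := 1) (by simp; norm_num)
      (by ext i; fin_cases i <;> simp <;> norm_num))
    (contrast_ne_zero (by simp))
    (le_dotProduct_gossip_mulVec hη.le hη1 hM) (dotProduct_gossip_mulVec_le hη1)
  rwa [div_one] at h

theorem card_filter_agents (P : ℕ → Fin 3 → Prop) [∀ p a, Decidable (P p a)] :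
    (Finset.univ.filter fun i : Fin ((M + 1) * 3) => P (pos i) (copy i)).card =
      ∑ p ∈ Finset.range (M + 1), ((if P p 0 then 1 else 0) + (if P p 1 then 1 else 0) +
        (if P p 2 then 1 else 0)) := by
  rw [Finset.card_filter]
  exact sum_agents fun p a => if P p a then 1 else 0

/-- The level of an agent is a distance to `A` truncated at `D = ⌈1 / (5 √η)⌉`, in the sense that it
changes by at most one along edges. -/
theorem exists_network {η : ℝ} (hη : 0 < η) (hη1 : η ≤ 1) :
    ∃ (m : ℕ) (hm : 2 ≤ m) (G : SimpleGraph (Fin m)) (W : Matrix (Fin m) (Fin m) ℝ)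
      (hW : IsGossipMatrix G W), G.Connected ∧ eigengap hm hW.posSemidef.isHermitian = η ∧
      ∃ (level : Fin m → ℕ) (A B : Finset (Fin m)) (r : ℕ),
        (∀ i, level i ≤ ⌈1 / (5 * √η)⌉₊) ∧ (∀ i j, G.Adj i j → level i ≤ level j + 1) ∧
        (∀ i ∈ A, level i = 0) ∧ (∀ i ∈ B, level i = ⌈1 / (5 * √η)⌉₊) ∧ Disjoint A B ∧
        A.card = r ∧ B.card = r ∧ m ≤ 4 * r := by
  set D := ⌈1 / (5 * √η)⌉₊ with hD
  have hsq : 0 < √η := Real.sqrt_pos.2 hη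
  have hD1 : 1 ≤ D := Nat.one_le_iff_ne_zero.2 (Nat.ceil_pos.2 (by positivity)).ne'
  -- If `D = 1`, two of three agents at a single position will do, for every `η ≤ 1`. If `D ≥ 2`,
  -- then `25 η (D - 1) ^ 2 < 1` leaves room for `2 D` positions, of which about `D / 2` at each end
  -- form `A` and `B`.
  rcases hD1.eq_or_lt with hD1 | hD2
  · obtain ⟨hW, he⟩ := exists_isGossipMatrix_gossip (M := 0) hη hη1 (by simp) (by norm_num)
    refine ⟨_, _, _, _, hW, thickPath_connected 0, he, fun i => if copy i = 0 then 0 else 1,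
      Finset.univ.filter (fun i => copy i = 0), Finset.univ.filter (fun i => copy i = 1), 1,
      ?_, ?_, ?_, ?_, ?_, ?_, ?_, by norm_num⟩
    · intro i; dsimp only; split_ifs <;> omega
    · intro i j _; dsimp only; split_ifs <;> omega
    · intro i hi; simpa using hi
    · intro i hi
      have : copy i = 1 := by simpa using hi
      simp [this, ← hD1]
    · refine Finset.disjoint_filter.2 fun i _ h h' => ?_
      rw [h] at h'; simp at h'
    · rw [card_filter_agents (fun _ a => a = 0)]; simp
    · rw [card_filter_agents (fun _ a => a = 1)]; simp
  · have hDη : η * (25 * ((D : ℝ) - 1) ^ 2) ≤ 1 := by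
      have h1 : ((D - 1 : ℕ) : ℝ) < 1 / (5 * √η) := Nat.lt_ceil.1 (by omega)
      rw [Nat.cast_sub hD1, Nat.cast_one, lt_div_iff₀ (by positivity)] at h1
      have h2 : (2 : ℝ) ≤ D := by exact_mod_cast hD2
      have h3 : (((D : ℝ) - 1) * (5 * √η)) ^ 2 ≤ 1 ^ 2 :=
        pow_le_pow_left₀ (mul_nonneg (by linarith) (by positivity)) h1.le 2
      have h4 := Real.sq_sqrt hη.le
      nlinarith
    have hM : η * (((2 * D - 1 : ℕ) + 1 : ℝ) * (2 * D - 1 : ℕ)) ≤ 1 / 2 := by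
      rw [Nat.cast_sub (by omega)]
      push_cast
      have h2 : (2 : ℝ) ≤ D := by exact_mod_cast hD2
      have h3 : 2 * ((2 * D - 1 + 1) * (2 * (D : ℝ) - 1)) ≤ 25 * ((D : ℝ) - 1) ^ 2 := by
        nlinarith [mul_nonneg (sub_nonneg.2 h2) (sub_nonneg.2 h2)]
      have := mul_le_mul_of_nonneg_left h3 hη.le
      linarith
    obtain ⟨hW, he⟩ := exists_isGossipMatrix_gossip (M := 2 * D - 1) hη hη1 hM (by omega)
    set q := (D + 1) / 2 with hq
    refine ⟨_, _, _, _, hW, thickPath_connected _, he, fun i => min (pos i - (q - 1)) D,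
      Finset.univ.filter (fun i => pos i < q),
      Finset.univ.filter (fun i => 2 * D - q ≤ pos i), 3 * q,
      ?_, ?_, ?_, ?_, ?_, ?_, ?_, by omega⟩
    · intro i; exact min_le_right _ _
    · intro i j h
      have := h.2.1
      simp only
      omega
    · intro i hi
      have : pos i < q := by simpa using hi
      simp only
      omega
    · intro i hi
      have : 2 * D - q ≤ pos i := (Finset.mem_filter.1 hi).2
      simp only
      omega
    · exact Finset.disjoint_filter.2 fun i _ h h' => by omega
    · rw [card_filter_agents (fun p _ => p < q)]
      have : (Finset.range (2 * D - 1 + 1)).filter (· < q) = Finset.range q := by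
        ext; simp; omega
      simp only [Finset.sum_add_distrib, Finset.sum_boole, this, Finset.card_range]
      simp only [Nat.cast_id]
      omega
    · rw [card_filter_agents (fun p _ => 2 * D - q ≤ p)]
      have : (Finset.range (2 * D - 1 + 1)).filter (2 * D - q ≤ ·) =
          Finset.Ico (2 * D - q) (2 * D) := by
        ext; simp; omega
      simp only [Finset.sum_add_distrib, Finset.sum_boole, this, Nat.card_Ico]
      simp only [Nat.cast_id]
      omega

end Network

/-! ### The hard instance -/

section Hard
variable {m d : ℕ}

/-- The hard local costs: even links in `A`, odd links in `B`, and `0` elsewhere. -/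
noncomputable def hardCost (n d : ℕ) (L : ℝ) (A B : Finset (Fin m)) (i : Fin m) : Vec d → ℝ :=
  if i ∈ A then linkCost n d L 0 else if i ∈ B then linkCost n d L 1 else 0

variable {n : ℕ} {L : ℝ} {A B : Finset (Fin m)}

theorem gradient_zero_fun {E : Type*} [NormedAddCommGroup E] [InnerProductSpace ℝ E]
    [CompleteSpace E] (v : E) : gradient (0 : E → ℝ) v = 0 := by
  have := hasGradientAt_const v (0 : ℝ)
  exact this.gradient

theorem isSmooth_hardCost (hL : 0 ≤ L) (i : Fin m) : IsSmooth L (hardCost n d L A B i) := by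
  unfold hardCost
  split_ifs
  · exact isSmooth_linkCost hL
  · exact isSmooth_linkCost hL
  · refine ⟨differentiable_const 0, fun x y => ?_⟩
    rw [gradient_zero_fun, gradient_zero_fun, sub_zero, norm_zero]
    positivity

theorem convexOn_hardCost (hL : 0 ≤ L) (i : Fin m) :
    ConvexOn ℝ Set.univ (hardCost n d L A B i) := by
  unfold hardCost
  split_ifs
  · exact convexOn_linkCost hL
  · exact convexOn_linkCost hL
  · exact convexOn_const 0 convex_univ

theorem hasGradientAt_hardCost (hL : 0 ≤ L) (i : Fin m) (v : Vec d) :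
    HasGradientAt (hardCost n d L A B i) (gradient (hardCost n d L A B i) v) v :=
  ((isSmooth_hardCost hL i).1 v).hasGradientAt

/-- Sums over the agents of a quantity that depends only on the local cost and vanishes for `0`. -/
theorem sum_hardCost_roles {R : Type*} [AddCommMonoid R] (hAB : Disjoint A B)
    (F : (Vec d → ℝ) → R) (hF : F 0 = 0) :
    ∑ i, F (hardCost n d L A B i) =
      A.card • F (linkCost n d L 0) + B.card • F (linkCost n d L 1) := by
  have h : ∀ i, F (hardCost n d L A B i) =
      (if i ∈ A then F (linkCost n d L 0) else 0) +
        (if i ∈ B then F (linkCost n d L 1) else 0) := by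
    intro i
    unfold hardCost
    by_cases hA : i ∈ A
    · simp [hA, Finset.disjoint_left.1 hAB hA]
    · by_cases hB : i ∈ B <;> simp [hA, hB, hF]
  simp only [h, Finset.sum_add_distrib, Finset.sum_ite_mem, Finset.univ_inter, Finset.sum_const]

theorem linkCost_bregman_nonneg (hL : 0 ≤ L) (s : ℕ) (v w : Vec d) :
    0 ≤ linkCost n d L s w - linkCost n d L s v - ⟪gradient (linkCost n d L s) v, w - v⟫ :=
  le_trans (by positivity) (le_linkCost_sub hL v w)

theorem hardCost_bregman_nonneg (hL : 0 ≤ L) (i : Fin m) (v w : Vec d) :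
    0 ≤ hardCost n d L A B i w - hardCost n d L A B i v -
      ⟪gradient (hardCost n d L A B i) v, w - v⟫ := by
  unfold hardCost
  split_ifs
  · exact linkCost_bregman_nonneg hL 0 v w
  · exact linkCost_bregman_nonneg hL 1 v w
  · simp [gradient_zero_fun]

theorem gradient_add_gradient_apply (hn : 1 ≤ n) (v : Vec d) (j : Fin d) :
    gradient (linkCost n d L 0) v j + gradient (linkCost n d L 1) v j =
      L / 2 * if (j : ℕ) < n then
        2 * chain n 1 v (j + 1) - (chain n 1 v j + chain n 1 v (j + 2)) else 2 * v j := by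
  rw [gradient_linkCost_apply hn zero_le_one, gradient_linkCost_apply hn le_rfl]
  split_ifs
  · rcases Nat.mod_two_eq_zero_or_one (j : ℕ) with h | h
    · rw [show partner 0 (j + 1) = j by unfold partner; split_ifs <;> omega,
        show partner 1 (j + 1) = j + 2 by unfold partner; split_ifs <;> omega]
      ring
    · rw [show partner 0 (j + 1) = j + 2 by unfold partner; split_ifs <;> omega,
        show partner 1 (j + 1) = j by unfold partner; split_ifs <;> omega]
      ring
  · ring

theorem gradient_add_gradient_eq_zero_iff (hL : 0 < L) (hn : 1 ≤ n) (hnd : n ≤ d) (v : Vec d) :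
    gradient (linkCost n d L 0) v + gradient (linkCost n d L 1) v = 0 ↔ v = ramp n d := by
  have hL2 : L / 2 ≠ 0 := by positivity
  constructor
  · intro h
    have h' : ∀ j : Fin d, _ := fun j => (gradient_add_gradient_apply (L := L) hn v j).symm.trans
      (by simpa using congrFun (congrArg WithLp.ofLp h) j)
    refine eq_ramp hnd (fun j hj => ?_) (fun j hj => ?_)
    · have := (mul_eq_zero.1 (h' j)).resolve_left hL2
      rw [if_pos hj] at this
      linarith
    · have := (mul_eq_zero.1 (h' j)).resolve_left hL2
      rw [if_neg (by omega)] at this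
      linarith
  · rintro rfl
    ext j
    rw [PiLp.add_apply, gradient_add_gradient_apply hn]
    split_ifs with hj
    · rw [chain_ramp hnd (by omega), chain_ramp hnd (by omega), chain_ramp hnd (by omega)]
      push_cast
      simp only [PiLp.zero_apply]
      ring
    · simp [ramp, hj]

theorem isSolution_hardCost_iff (hL : 0 < L) (hn : 1 ≤ n) (hnd : n ≤ d) (hAB : Disjoint A B)
    {r : ℕ} (hr : 0 < r) (hA : A.card = r) (hB : B.card = r) (v : Vec d) :
    IsSolution (hardCost n d L A B) v ↔ v = ramp n d := by
  have hsum : ∀ w : Vec d, ∑ i, gradient (hardCost n d L A B i) w =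
      r • (gradient (linkCost n d L 0) w + gradient (linkCost n d L 1) w) := by
    intro w
    rw [sum_hardCost_roles hAB (fun f => gradient f w) (gradient_zero_fun w), hA, hB, smul_add]
  constructor
  · intro h
    rw [← gradient_add_gradient_eq_zero_iff hL hn hnd]
    have hmin : IsLocalMin (fun y => ∑ i, hardCost n d L A B i y) v :=
      Filter.Eventually.of_forall h
    have hder : HasFDerivAt (fun y => ∑ i, hardCost n d L A B i y)
        (InnerProductSpace.toDual ℝ (Vec d) (∑ i, gradient (hardCost n d L A B i) v)) v := by
      rw [map_sum]
      exact HasFDerivAt.fun_sum fun i _ =>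
        hasGradientAt_iff_hasFDerivAt.1 (hasGradientAt_hardCost hL.le i v)
    have h0 := hmin.hasFDerivAt_eq_zero hder
    rw [map_eq_zero_iff _ (InnerProductSpace.toDual ℝ (Vec d)).injective, hsum,
      ← Nat.cast_smul_eq_nsmul ℝ] at h0
    exact (smul_eq_zero.1 h0).resolve_left (by positivity)
  · rintro rfl y
    have h : 0 ≤ ∑ i, (hardCost n d L A B i y - hardCost n d L A B i (ramp n d) -
      ⟪gradient (hardCost n d L A B i) (ramp n d), y - ramp n d⟫) :=
      Finset.sum_nonneg fun i _ => hardCost_bregman_nonneg hL.le i _ _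
    rw [Finset.sum_sub_distrib, Finset.sum_sub_distrib, ← sum_inner, hsum,
      (gradient_add_gradient_eq_zero_iff hL hn hnd _).2 rfl, smul_zero, inner_zero_left] at h
    linarith

theorem norm_consensus_sq (v : Vec d) : ‖(0 : Stack m d) - consensus m v‖ ^ 2 = m * ‖v‖ ^ 2 := by
  rw [zero_sub, norm_neg, PiLp.norm_sq_eq_of_L2]
  simp [consensus]

theorem norm_gradient_stackedCost_sq (hL : 0 ≤ L) (hn : 1 ≤ n) (hnd : n ≤ d) (hAB : Disjoint A B)
    {r : ℕ} (hA : A.card = r) (hB : B.card = r) :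
    ‖gradient (stackedCost (hardCost n d L A B)) (consensus m (ramp n d))‖ ^ 2 =
      r * (n * L ^ 2) / (2 * (n + 1) ^ 2) := by
  rw [(hasGradientAt_stackedCost (x := consensus m (ramp n d)) fun i =>
    hasGradientAt_hardCost hL i _).gradient, PiLp.norm_sq_eq_of_L2]
  have h := sum_hardCost_roles (n := n) (L := L) hAB (fun f => ‖gradient f (ramp n d)‖ ^ 2)
    (by simp [gradient_zero_fun])
  refine Eq.trans h ?_
  rw [norm_gradient_linkCost_ramp_sq hn zero_le_one hnd,
    norm_gradient_linkCost_ramp_sq hn le_rfl hnd, hA, hB]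
  simp only [nsmul_eq_mul]
  field_simp
  ring

theorem le_bregman_hardCost (hL : 0 ≤ L) (hnd : n ≤ d) {k : ℕ} (hkn : k ≤ n) (hAB : Disjoint A B)
    {r : ℕ} (hA : A.card = r) (hB : B.card = r) {x : Stack m d}
    (hx : ∀ i, x i ∈ firstCoords d k) :
    r * (L * (n - k) / (8 * (n + 1) ^ 2)) ≤
      bregman (hardCost n d L A B) x (consensus m (ramp n d)) := by
  rw [bregman_eq_sum x (fun i => hasGradientAt_hardCost hL i _)]
  have hsub : ∀ S : Finset (Fin m), S.card = r → (∀ i ∈ S, L * (n - k) / (8 * (n + 1) ^ 2) ≤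
      hardCost n d L A B i (x i) - hardCost n d L A B i (ramp n d) -
        ⟪gradient (hardCost n d L A B i) (ramp n d), x i - ramp n d⟫) →
      r * (L * (n - k) / (8 * (n + 1) ^ 2)) ≤
        ∑ i, (hardCost n d L A B i (x i) - hardCost n d L A B i (ramp n d) -
          ⟪gradient (hardCost n d L A B i) (ramp n d), x i - ramp n d⟫) := by
    intro S hS hle
    refine le_trans ?_ (Finset.sum_le_sum_of_subset_of_nonneg (Finset.subset_univ S)
      fun i _ _ => hardCost_bregman_nonneg hL i _ _)
    rw [← nsmul_eq_mul, ← hS]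
    exact Finset.card_nsmul_le_sum S _ _ hle
  -- Of the two sets, the one whose links do not join coordinate `k` to its predecessor is used.
  rcases Nat.mod_two_eq_zero_or_one k with hk | hk
  · refine hsub B hB fun i hi => ?_
    rw [hardCost, if_neg (Finset.disjoint_right.1 hAB hi), if_pos hi]
    exact le_linkCost_sub_ramp hL hnd (by omega) hkn (hx i)
  · refine hsub A hA fun i hi => ?_
    rw [hardCost, if_pos hi]
    exact le_linkCost_sub_ramp hL hnd (by omega) hkn (hx i)

theorem hardCost_reach (hn : 1 ≤ n) {G : SimpleGraph (Fin m)} {τ : ℝ} (hτ : 0 < τ)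
    {x : ℝ → Stack m d} (hx : IsGossipTrajectory G τ (hardCost n d L A B) x)
    {D : ℕ} {level : Fin m → ℕ} (hD : ∀ i, level i ≤ D)
    (hadj : ∀ i j, G.Adj i j → level i ≤ level j + 1) (hA : ∀ i ∈ A, level i = 0)
    (hB : ∀ i ∈ B, level i = D) {t : ℝ} (ht : 0 ≤ t) {k : ℕ} (htk : t ≤ k * (1 + D * τ))
    (i : Fin m) : x t i ∈ firstCoords d k := by
  have hsucc : ∀ s ≤ 1, ∀ (k : ℕ) (v : Vec d), v ∈ firstCoords d k →
      gradient (linkCost n d L s) v ∈ firstCoords d (k + 1) := fun s hs k v hv =>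
    gradient_linkCost_mem hn hs (Nat.le_succ k) hv
      fun j hj => lt_partner (Nat.le_of_succ_le hj) (Or.inr hj)
  have hstay : ∀ s ≤ 1, ∀ (k : ℕ) (v : Vec d), (k + s) % 2 = 1 → v ∈ firstCoords d k →
      gradient (linkCost n d L s) v ∈ firstCoords d k := fun s hs k v hk hv =>
    gradient_linkCost_mem hn hs le_rfl hv fun j hj => lt_partner hj (Or.inl hk)
  refine mem_firstCoords_of_le hτ hx hD hadj ?_ ?_ ht i k ?_
  · intro i k v hv
    unfold hardCost
    split_ifs
    · exact hsucc 0 zero_le_one k v hv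
    · exact hsucc 1 le_rfl k v hv
    · rw [gradient_zero_fun]; exact zero_mem _
  · intro i k v hsrc hv
    unfold hardCost
    split_ifs with h1 h2
    · refine hstay 0 zero_le_one k v ?_ hv
      rw [hA i h1] at hsrc
      unfold sourceDist at hsrc
      split_ifs at hsrc <;> omega
    · refine hstay 1 le_rfl k v ?_ hv
      rw [hB i h2] at hsrc
      unfold sourceDist at hsrc
      split_ifs at hsrc <;> omega
    · rw [gradient_zero_fun]; exact zero_mem _
  · push_cast
    have : 0 ≤ (sourceDist D k (level i) : ℝ) * τ := by positivity
    nlinarith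

end Hard

/-- The comparison of constants. Here `R ^ 2` is of the order `m n`, `g ^ 2` of the order
`m L ^ 2 / n`, so that `g` is comparable to `L R / (T + 2)` and both terms of the lower bound are of
the order `m L / n`. -/
theorem rate_bounds {m n r L T R g : ℝ} (hL : 0 < L) (hn : 1 ≤ n) (hT : 0 ≤ T)
    (hTn : T + 2 ≤ 2 * (n + 1)) (hnT : n + 1 ≤ 2 * (T + 2)) (hm : 0 < m) (hr1 : m ≤ 4 * r)
    (hr2 : 2 * r ≤ m) (hR0 : 0 ≤ R) (hg0 : 0 ≤ g)
    (hR : R ^ 2 = m * (n * (2 * n + 1) / (6 * (n + 1))))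
    (hg : g ^ 2 = r * (n * L ^ 2) / (2 * (n + 1) ^ 2)) :
    0 < R ∧ 1 / 384 * (L * R ^ 2 / (T + 2) ^ 2 + R * g / (T + 2)) ≤ r * (L / (24 * (n + 1))) ∧
      1 / 384 * (R * g) ≤ L * R ^ 2 / (T + 2) ∧ L * R ^ 2 / (T + 2) ≤ 4 * (R * g) := by
  have hT2 : 0 < T + 2 := by linarith
  have hn1 : 0 < n + 1 := by linarith
  have hRpos : 0 < R := by
    refine lt_of_le_of_ne hR0 ?_
    rintro rfl
    have : 0 < m * (n * (2 * n + 1) / (6 * (n + 1))) := by positivity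
    rw [← hR] at this
    norm_num at this
  have hR1 : R ^ 2 ≤ m * n / 3 := by
    rw [hR, mul_div_assoc m n]
    refine mul_le_mul_of_nonneg_left ?_ hm.le
    rw [div_le_div_iff₀ (by positivity) (by norm_num)]
    nlinarith
  have hR2 : m * n / 4 ≤ R ^ 2 := by
    rw [hR, mul_div_assoc m n]
    refine mul_le_mul_of_nonneg_left ?_ hm.le
    rw [div_le_div_iff₀ (by norm_num) (by positivity)]
    nlinarith
  have hg1 : g ^ 2 ≤ m * n * L ^ 2 / (4 * (n + 1) ^ 2) := by
    rw [hg, div_le_div_iff₀ (by positivity) (by positivity)]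
    have : 0 ≤ n * L ^ 2 * (n + 1) ^ 2 := by positivity
    nlinarith
  have hg2 : m * n * L ^ 2 / (8 * (n + 1) ^ 2) ≤ g ^ 2 := by
    rw [hg, div_le_div_iff₀ (by positivity) (by positivity)]
    have : 0 ≤ n * L ^ 2 * (n + 1) ^ 2 := by positivity
    nlinarith
  set q := L * R / (T + 2) with hq
  have hq0 : 0 ≤ q := by positivity
  have hmnL : 0 ≤ m * n * L ^ 2 := by positivity
  have hgq : g ≤ 2 * q := by
    refine le_of_sq_le_sq (hg1.trans ?_) (by positivity)
    rw [hq, mul_pow, div_pow, mul_pow, ← mul_div_assoc,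
      div_le_div_iff₀ (by positivity) (by positivity)]
    have h1 : (T + 2) ^ 2 ≤ (2 * (n + 1)) ^ 2 := pow_le_pow_left₀ hT2.le hTn 2
    calc m * n * L ^ 2 * (T + 2) ^ 2 ≤ m * n * L ^ 2 * (2 * (n + 1)) ^ 2 := by gcongr
      _ = (2 ^ 2 * (L ^ 2 * (m * n / 4))) * (4 * (n + 1) ^ 2) := by ring
      _ ≤ (2 ^ 2 * (L ^ 2 * R ^ 2)) * (4 * (n + 1) ^ 2) := by gcongr
  have hqg : q ≤ 4 * g := by
    refine le_of_sq_le_sq ?_ (by positivity)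
    rw [mul_pow]
    refine le_trans ?_ (mul_le_mul_of_nonneg_left hg2 (by positivity))
    rw [hq, div_pow, mul_pow, ← mul_div_assoc, div_le_div_iff₀ (by positivity) (by positivity)]
    have h1 : (n + 1) ^ 2 ≤ (2 * (T + 2)) ^ 2 := pow_le_pow_left₀ hn1.le hnT 2
    calc L ^ 2 * R ^ 2 * (8 * (n + 1) ^ 2) ≤ L ^ 2 * (m * n / 3) * (8 * (2 * (T + 2)) ^ 2) := by
          gcongr
      _ = 32 / 3 * (m * n * L ^ 2) * (T + 2) ^ 2 := by ring
      _ ≤ 4 ^ 2 * (m * n * L ^ 2) * (T + 2) ^ 2 := by gcongr; norm_num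
  have e1 : L * R ^ 2 / (T + 2) = R * q := by rw [hq]; ring
  have e2 : L * R ^ 2 / (T + 2) ^ 2 = R * q / (T + 2) := by rw [hq]; field_simp
  have hRg : R * g ≤ 2 * (R * q) := by nlinarith
  have hRq : R * q ≤ 4 * (R * g) := by nlinarith
  have hRq0 : 0 ≤ R * q := by positivity
  refine ⟨hRpos, ?_, ?_, ?_⟩
  · have h1 : R * g / (T + 2) ≤ 2 * (R * q / (T + 2)) := by
      rw [← mul_div_assoc]; gcongr
    have h2 : R * q / (T + 2) ≤ 4 / 3 * (m * (L / (n + 1))) := by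
      rw [← e2]
      calc L * R ^ 2 / (T + 2) ^ 2 ≤ L * (m * n / 3) / ((n + 1) / 2) ^ 2 := by
            gcongr; linarith
        _ = 4 / 3 * (m * (L / (n + 1))) * (n / (n + 1)) := by field_simp; norm_num
        _ ≤ 4 / 3 * (m * (L / (n + 1))) * 1 := by
            gcongr
            rw [div_le_one hn1]; linarith
        _ = _ := by ring
    have h3 : m * (L / (n + 1)) ≤ 4 * r * (L / (n + 1)) := by gcongr
    have h4 : r * (L / (24 * (n + 1))) = r * (L / (n + 1)) / 24 := by field_simp
    rw [e2, h4]
    linarith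
  · rw [e1]; linarith
  · rw [e1]; exact hRq

end DecentralizedOpt

open DecentralizedOpt in
theorem theorem1 :
    ∃ c C : ℝ, 0 < c ∧ 0 < C ∧
      ∀ η : ℝ, 0 < η → η ≤ 1 → ∀ L : ℝ, 0 < L →
        ∃ (m : ℕ) (hm : 2 ≤ m) (G : SimpleGraph (Fin m)) (W : Matrix (Fin m) (Fin m) ℝ)
          (hW : IsGossipMatrix G W),
          G.Connected ∧ eigengap hm hW.posSemidef.isHermitian = η ∧
          ∀ (d : ℕ) (τ : ℝ), 0 < τ →
            ∀ t : ℝ, 0 ≤ t → t ≤ ((d : ℝ) - 1) / 2 * timeScale η τ →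
              ∃ f : Fin m → Vec d → ℝ,
                (∀ i, ConvexOn ℝ Set.univ (f i)) ∧
                (∀ i, IsSmooth L (f i)) ∧
                IsSmooth L (stackedCost f) ∧
                (∃ xs : Vec d, IsSolution f xs) ∧
                ∀ xs : Vec d, IsSolution f xs →
                  0 < ‖(0 : Stack m d) - consensus m xs‖ ∧
                  (∀ x : ℝ → Stack m d, IsGossipTrajectory G τ f x →
                    c * (L * ‖x 0 - consensus m xs‖ ^ 2 / (t / timeScale η τ + 2) ^ 2 +
                        ‖x 0 - consensus m xs‖ *
                          ‖gradient (stackedCost f) (consensus m xs)‖ /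
                            (t / timeScale η τ + 2))
                      ≤ bregman f (x t) (consensus m xs)) ∧
                  c * (‖(0 : Stack m d) - consensus m xs‖ *
                        ‖gradient (stackedCost f) (consensus m xs)‖)
                    ≤ L * ‖(0 : Stack m d) - consensus m xs‖ ^ 2 / (t / timeScale η τ + 2) ∧
                  L * ‖(0 : Stack m d) - consensus m xs‖ ^ 2 / (t / timeScale η τ + 2)
                    ≤ C * (‖(0 : Stack m d) - consensus m xs‖ *
                        ‖gradient (stackedCost f) (consensus m xs)‖) := by
  refine ⟨1 / 384, 4, by norm_num, by norm_num, fun η hη hη1 L hL => ?_⟩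
  obtain ⟨m, hm, G, W, hW, hconn, hgap, level, A, B, r, hlev, hadj, hlA, hlB, hAB, hA, hB, hmr⟩ :=
    exists_network hη hη1
  refine ⟨m, hm, G, W, hW, hconn, hgap, fun d τ hτ t ht htd => ?_⟩
  have hr : 0 < r := by omega
  have h2r : 2 * r ≤ m := by
    have := Finset.card_le_univ (A ∪ B)
    rw [Finset.card_union_of_disjoint hAB, Fintype.card_fin] at this
    omega
  set σ := timeScale η τ with hσ
  have hσ0 : 0 < σ := by rw [hσ, timeScale]; positivity
  set T := t / σ with hT
  have hT0 : 0 ≤ T := by positivity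
  have hTd : T ≤ ((d : ℝ) - 1) / 2 := (div_le_iff₀ hσ0).2 htd
  set k := ⌈T⌉₊ with hk
  have hTk : T ≤ k := Nat.le_ceil T
  have hkT : (k : ℝ) < T + 1 := Nat.ceil_lt_add_one hT0
  have hd1 : 1 ≤ d := by
    have : (1 : ℝ) ≤ d := by linarith
    exact_mod_cast this
  have hkd : 2 * k ≤ d := by
    have : (2 * k : ℝ) < d + 1 := by linarith
    have : 2 * k < d + 1 := by exact_mod_cast this
    omega
  -- For `T = 0` no coordinate is reached, and a single one is needed to have `R > 0`.
  set n := max (2 * k) 1 with hn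
  have hn1 : 1 ≤ n := le_max_right _ _
  have hnd : n ≤ d := max_le hkd hd1
  have hkn : k ≤ n := by omega
  have hn1' : (1 : ℝ) ≤ n := by exact_mod_cast hn1
  have hkn' : (2 * k : ℝ) ≤ n := by exact_mod_cast le_max_left (2 * k) 1
  have hnT : (n : ℝ) + 1 ≤ 2 * (T + 2) := by
    have h1 : n ≤ 2 * k + 1 := by omega
    have h2 : (n : ℝ) ≤ 2 * k + 1 := by exact_mod_cast h1
    linarith
  have hgapk : (n : ℝ) + 1 ≤ 3 * (n - k) := by
    have h1 : n + 1 + 3 * k ≤ 3 * n := by omega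
    have h2 : (n : ℝ) + 1 + 3 * k ≤ 3 * n := by exact_mod_cast h1
    linarith
  obtain ⟨h1, h2, h3, h4⟩ := rate_bounds (m := m) (n := n) (r := r) (L := L) (T := T) hL
    hn1' hT0 (by linarith) hnT (by positivity) (by exact_mod_cast hmr) (by exact_mod_cast h2r)
    (norm_nonneg ((0 : Stack m d) - consensus m (ramp n d)))
    (norm_nonneg (gradient (stackedCost (hardCost n d L A B)) (consensus m (ramp n d))))
    (by rw [norm_consensus_sq, norm_ramp_sq hnd])
    (norm_gradient_stackedCost_sq hL.le hn1 hnd hAB hA hB)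
  refine ⟨hardCost n d L A B, convexOn_hardCost hL.le, isSmooth_hardCost hL.le,
    isSmooth_stackedCost hL.le (isSmooth_hardCost hL.le),
    ⟨ramp n d, (isSolution_hardCost_iff hL hn1 hnd hAB hr hA hB _).2 rfl⟩, fun xs hxs => ?_⟩
  obtain rfl := (isSolution_hardCost_iff hL hn1 hnd hAB hr hA hB _).1 hxs
  refine ⟨h1, fun x hx => ?_, h3, h4⟩
  rw [hx.1]
  have hreach : ∀ i, x t i ∈ firstCoords d k :=
    hardCost_reach hn1 hτ hx hlev hadj hlA hlB ht ((div_le_iff₀ hσ0).1 hTk)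
  refine h2.trans (le_trans ?_ (le_bregman_hardCost hL.le hnd hkn hAB hA hB hreach))
  refine mul_le_mul_of_nonneg_left ?_ (Nat.cast_nonneg r)
  rw [div_le_div_iff₀ (by positivity) (by positivity)]
  have h5 : 0 ≤ L * (n + 1) := by positivity
  nlinarith [mul_le_mul_of_nonneg_left hgapk h5]
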